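/- Let $M$ be a smooth compact connected Riemannian manifold without boundary, of dimension $n$, with geodesic distance $d$ and Riemannian volume measure $\mu$. Let $P$ denote the orthogonal projection of $L^2(M)=L^2(M,\mu;\mathbb{C})$ onto the constant functions. Let $K_t(x,y)$ be a complex-valued function which is smooth in $(t,x,y)$ for $t>0$, $x,y\in M$, and for $t>0$ and $F\in L^2(M)$ put $$(T_tF)(x)=\int_M K_t(x,y)F(y)\,d\mu(y)\qquad(x\in M).$$ Suppose that $K_t(x,y)$ is a continuous $\mathcal{S}$-wavelet on $M$, that is: (i) for some $c>0$, $\int_0^\infty \|T_tF\|_2^2\,\frac{dt}{t}=c\,\|(I-P)F\|_2^2$ for all $F\in L^2(M)$; (ii) $\int_M K_t(x,y)\,d\mu(y)=0$ for all $t>0$ and all $x\in M$; (iii) $\int_M K_t(x,y)\,d\mu(x)=0$ for all $t>0$ and all $y\in M$; (iv) for all integers $j,k,N\ge 0$ and all linear differential operators with $C^\infty$ complex coefficients $X$ (acting in $x$, of degree at most $j$) and $Y$ (acting in $y$, of degree at most $k$) on $M$, there is a constant $C_{N,X,Y}$ such that $$t^{\,n+j+k}\left|\left(\frac{d(x,y)}{t}\right)^{N}XYK_t(x,y)\right|\le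 C_{N,X,Y}\qquad\text{for all }t>0\text{ and all }x,y\in M.$$ Let $F\in L^2(M)$, and call $F$ Hölder continuous with exponent $\alpha$ if, after modification on a $\mu$-null set, $|F(x)-F(y)|\le C'd(x,y)^\alpha$ for some constant $C'$ and all $x,y\in M$. Then: (a) If $0<\alpha\le 1$ and $F$ is Hölder continuous with exponent $\alpha$, then for some $C>0$, $$\sup_{x\in M}|(T_tF)(x)|\le C\,t^{\alpha}\qquad\text{for all }t>0.\tag{1}$$ (b) Conversely, if $0<\alpha<1$, $C>0$, and $F$ satisfies (1), then $F$ is Hölder continuous with exponent $\alpha$. -/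

import Mathlib

open Set Filter MeasureTheory Manifold Bundle
open scoped ENNReal NNReal ContDiff Topology

/-- `𝔼 n` is the Euclidean space `ℝⁿ`, the model space of an `n`-dimensional manifold. -/
notation "𝔼" n => EuclideanSpace ℝ (Fin n)

section Geometry

variable (n : ℕ) (M : Type*) [MetricSpace M] [ChartedSpace (𝔼 n) M]
  [RiemannianBundle (fun x : M => TangentSpace (𝓡 n) x)]

/-- The `i`-th coordinate vector field `∂ᵢ` of the chart `chartAt x`, at the point with
coordinates `u`: the image of the `i`-th basis vector under the derivative of the inverse chart. -/
noncomputable def coordVector (x : M) (u : 𝔼 n) (i : Fin n) :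
    TangentSpace (𝓡 n) ((chartAt (𝔼 n) x).symm u) :=
  mfderiv (𝓡 n) (𝓡 n) (chartAt (𝔼 n) x).symm u (EuclideanSpace.single i (1 : ℝ))

/-- The matrix `g_{ij}(u) = ⟨∂ᵢ, ∂ⱼ⟩` of the Riemannian metric in the chart `chartAt x`. -/
noncomputable def metricMatrix (x : M) (u : 𝔼 n) : Matrix (Fin n) (Fin n) ℝ :=
  Matrix.of fun i j => inner ℝ (coordVector n M x u i) (coordVector n M x u j)

/-- The measure `√(det g_{ij}(u)) du` on the domain of the chart `chartAt x`, seen as a measure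
on `M` (it gives mass zero to the complement of the domain of the chart). -/
noncomputable def chartVolume [MeasurableSpace M] (x : M) : Measure M :=
  (((volume : Measure (𝔼 n)).restrict (chartAt (𝔼 n) x).target).withDensity
    fun u => ENNReal.ofReal (Real.sqrt (metricMatrix n M x u).det)).map (chartAt (𝔼 n) x).symm

/-- The Riemannian volume measure. The measures `chartVolume n M x` agree on the overlaps of the
chart domains (change of variables), and the volume measure is the measure on `M` whose restriction
to the domain of each chart is `√(det g_{ij}(u)) du`: the least measure that dominates all of
them. -/
noncomputable def riemannianVolume [MeasurableSpace M] : Measure M :=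
  ⨆ x : M, chartVolume n M x

end Geometry

section DifferentialOperators

variable (n : ℕ) {M : Type*} [TopologicalSpace M] [ChartedSpace (𝔼 n) M] [IsManifold (𝓡 n) ∞ M]

/-- The derivative `V f` of a complex-valued function `f` along a vector field `V`. -/
noncomputable def derivAlong (V : ∀ x : M, TangentSpace (𝓡 n) x) (f : M → ℂ) (x : M) : ℂ :=
  (mfderiv (𝓡 n) 𝓘(ℝ, ℂ) f x : TangentSpace (𝓡 n) x →L[ℝ] ℂ) (V x)

/-- `IsDiffOp n k X`: `X` is a linear differential operator on `M` with (complex) `C^∞`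
coefficients, of degree at most `k`. These are the finite sums of operators
`f ↦ a • V₁ (b • V₂ (… f))` with at most `k` smooth vector fields `Vᵢ` and with smooth functions
`a`, `b`, …; operators are only meant to be applied to smooth functions. -/
inductive IsDiffOp : ℕ → ((M → ℂ) → M → ℂ) → Prop
  | id : IsDiffOp 0 (fun f => f)
  | smul {k : ℕ} {X : (M → ℂ) → M → ℂ} (a : M → ℂ) (ha : ContMDiff (𝓡 n) 𝓘(ℝ, ℂ) ∞ a)
      (hX : IsDiffOp k X) : IsDiffOp k (fun f x => a x * X f x)
  | add {k : ℕ} {X Y : (M → ℂ) → M → ℂ} (hX : IsDiffOp k X) (hY : IsDiffOp k Y) :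
      IsDiffOp k (fun f x => X f x + Y f x)
  | deriv {k : ℕ} {X : (M → ℂ) → M → ℂ} (V : ∀ x : M, TangentSpace (𝓡 n) x)
      (hV : ContMDiff (𝓡 n) (𝓡 n).tangent ∞ (fun x => (⟨x, V x⟩ : TangentBundle (𝓡 n) M)))
      (hX : IsDiffOp k X) : IsDiffOp (k + 1) (fun f => derivAlong n V (X f))
  | succ {k : ℕ} {X : (M → ℂ) → M → ℂ} (hX : IsDiffOp k X) : IsDiffOp (k + 1) X

end DifferentialOperators

section Wavelets

variable (n : ℕ) {M : Type*} [MetricSpace M] [ChartedSpace (𝔼 n) M] [IsManifold (𝓡 n) ∞ M]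
  [RiemannianBundle (fun x : M => TangentSpace (𝓡 n) x)] [MeasurableSpace M]

/-- The operator `T_t` with kernel `K_t`: `(T_t F)(x) = ∫ K_t(x, y) F(y) dμ(y)`. -/
noncomputable def kernelOp (K : ℝ → M → M → ℂ) (t : ℝ) (F : M → ℂ) (x : M) : ℂ :=
  ∫ y, K t x y * F y ∂(riemannianVolume n M)

/-- The orthogonal projection `P` of `L²(M)` onto the constant functions:
`P F = μ(M)⁻¹ ∫ F dμ`. -/
noncomputable def constProj (F : M → ℂ) (_ : M) : ℂ :=
  ⨍ y, F y ∂(riemannianVolume n M)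

/-- `K_t(x, y)` is a continuous wavelet on `M`. -/
structure IsContinuousWavelet (K : ℝ → M → M → ℂ) : Prop where
  /-- `K_t(x, y)` is a smooth function of `(t, x, y)` for `t > 0`. -/
  smooth : ContMDiffOn (𝓘(ℝ, ℝ).prod ((𝓡 n).prod (𝓡 n))) 𝓘(ℝ, ℂ) ∞
    (fun p : ℝ × M × M => K p.1 p.2.1 p.2.2) (Ioi 0 ×ˢ univ)
  /-- `∫₀^∞ ‖T_t F‖₂² dt/t = c ‖(I - P) F‖₂²` for all `F ∈ L²`, for some `c > 0`. -/
  isometry : ∃ c : ℝ, 0 < c ∧ ∀ F : M → ℂ, MemLp F 2 (riemannianVolume n M) →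
    ∫⁻ t in Ioi (0 : ℝ),
        eLpNorm (kernelOp n K t F) 2 (riemannianVolume n M) ^ 2 / ENNReal.ofReal t
      = ENNReal.ofReal c * eLpNorm (F - constProj n F) 2 (riemannianVolume n M) ^ 2
  /-- `∫ K_t(x, y) dμ(y) = 0` for all `t > 0` and all `x`. -/
  integral_right : ∀ t : ℝ, 0 < t → ∀ x : M, ∫ y, K t x y ∂(riemannianVolume n M) = 0
  /-- `∫ K_t(x, y) dμ(x) = 0` for all `t > 0` and all `y`. -/
  integral_left : ∀ t : ℝ, 0 < t → ∀ y : M, ∫ x, K t x y ∂(riemannianVolume n M) = 0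

/-- `K_t(x, y)` is a continuous `𝒮`-wavelet on `M`: a continuous wavelet such that, for all smooth
differential operators `X` (in `x`, of degree `j`) and `Y` (in `y`, of degree `k`) and all `N`,
`t^(n+j+k) |(d(x, y) / t)^N X Y K_t(x, y)|` is bounded, uniformly in `t > 0` and `x, y ∈ M`. -/
structure IsContinuousSWavelet (K : ℝ → M → M → ℂ) : Prop extends IsContinuousWavelet n K where
  decay : ∀ (j k : ℕ) (X Y : (M → ℂ) → M → ℂ), IsDiffOp n j X → IsDiffOp n k Y → ∀ N : ℕ,
    ∃ C : ℝ, ∀ t : ℝ, 0 < t → ∀ x y : M,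
      t ^ (n + j + k) * ((dist x y / t) ^ N * ‖X (fun x' => Y (fun y' => K t x' y') y) x‖) ≤ C

/-- The element of `L²(M)` represented by `F` is Hölder continuous with exponent `α` with respect
to the geodesic distance: it has a Hölder continuous representative. -/
def IsHolderClass (α : ℝ≥0) (F : M → ℂ) : Prop :=
  ∃ G : M → ℂ, F =ᵐ[riemannianVolume n M] G ∧ ∃ C : ℝ≥0, HolderWith C α G

end Wavelets

/-! Part (a) is cancellation. As `K_t(x, ·)` has integral zero, `F(y)` may be replaced by `F(y) -
F(x) = O(d(x,y)^α)`. By (iv) the kernel is dominated by `t⁻ⁿ (1 + d/t)⁻⁽ⁿ⁺¹⁾`, with a power of `1 +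
d/t` to spare that turns `d^α` into `t^α`. The integral of this weight is bounded uniformly in `t`
because balls of radius `r` have volume `O(rⁿ)`.

Part (b) is duality. Polarizing (i) gives `Re ∫ ⟨T_t F, T_t H⟩ dt/t = c Re ⟨(I - P)F, H⟩` for `H` of
mean zero. By Fubini the inner integral on the left is `∫ s_t H dμ`, where `s_t(y) = ∫ conj(T_t
F(x)) K_t(x,y) dμ(x)`. The bound on `T_t F` and the size and smoothness of `K_t` give `|s_t(y) -
s_t(y')| ≤ C' t^α min(1, d(y,y')/t)`, whose integral against `dt/t` is `O(d(y,y')^α)` when `0 < α <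
1`. Hence `g(y) = ∫ (s_t(y) - s_t(x₀)) dt/t` converges and is Hölder. Put `G = conj(g)/c`. Testing
with `H = (I - P)(F - G)` yields `‖H‖₂ = 0`, so `F` is `G` plus a constant almost everywhere.

The geometry enters through `exists_riemannianVolume_ball_le` (volume of balls) and
`IsContinuousSWavelet.exists_isDecayingKernel` (from differential operators to size and Lipschitz
bounds). The analysis, on a compact metric space with a finite measure, is in
`IsDecayingKernel.norm_integral_le_of_holder` for (a) and
`IsDecayingKernel.exists_holder_of_norm_transform_le` for (b). -/

set_option linter.unusedSectionVars false

/-! ### Mean value inequality along curves. -/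

section MeanValue

variable {n : ℕ} {M : Type*} {E : Type*} [NormedAddCommGroup E] [NormedSpace ℝ E]

/-- The derivative of a vector-valued function in the direction of a tangent vector. -/
noncomputable def dirDeriv [TopologicalSpace M] [ChartedSpace (𝔼 n) M] (f : M → E) (z : M)
    (v : TangentSpace (𝓡 n) z) : E :=
  mfderiv (𝓡 n) 𝓘(ℝ, E) f z v

theorem enorm_sub_le_mul_pathELength [TopologicalSpace M] [ChartedSpace (𝔼 n) M]
    [RiemannianBundle (fun x : M => TangentSpace (𝓡 n) x)]
    {f : M → E} {C : ℝ≥0} {γ : ℝ → M}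
    (hγ : ContMDiff 𝓘(ℝ, ℝ) (𝓡 n) 1 γ)
    (hf : ∀ t ∈ Icc (0 : ℝ) 1, ContMDiffAt (𝓡 n) 𝓘(ℝ, E) 1 f (γ t))
    (hC : ∀ t ∈ Icc (0 : ℝ) 1, ∀ v : TangentSpace (𝓡 n) (γ t), ‖dirDeriv f (γ t) v‖ₑ ≤ C * ‖v‖ₑ) :
    ‖f (γ 1) - f (γ 0)‖ₑ ≤ C * pathELength (𝓡 n) γ 0 1 := by
  have hc : ContMDiffOn 𝓘(ℝ, ℝ) 𝓘(ℝ, E) 1 (f ∘ γ) (Icc 0 1) := fun t ht =>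
    ((hf t ht).comp t hγ.contMDiffAt).contMDiffWithinAt
  calc
    ‖f (γ 1) - f (γ 0)‖ₑ ≤ ∫⁻ t in Icc (0 : ℝ) 1, ‖derivWithin (f ∘ γ) (Icc 0 1) t‖ₑ :=
      enorm_sub_le_lintegral_derivWithin_Icc_of_contDiffOn_Icc
        (contMDiffOn_iff_contDiffOn.1 hc) zero_le_one
    _ ≤ ∫⁻ t in Icc (0 : ℝ) 1, C * ‖mfderivWithin 𝓘(ℝ, ℝ) (𝓡 n) γ (Icc 0 1) t 1‖ₑ := by
      apply setLIntegral_mono' measurableSet_Icc (fun t ht ↦ ?_)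
      have h1 : mfderivWithin 𝓘(ℝ, ℝ) 𝓘(ℝ, E) (f ∘ γ) (Icc 0 1) t =
          (mfderiv (𝓡 n) 𝓘(ℝ, E) f (γ t)) ∘L (mfderivWithin 𝓘(ℝ, ℝ) (𝓡 n) γ (Icc 0 1) t) := by
        apply mfderiv_comp_mfderivWithin
        · exact (hf t ht).mdifferentiableAt one_ne_zero
        · exact (hγ.mdifferentiable one_ne_zero).mdifferentiableOn _ ht
        · rw [uniqueMDiffWithinAt_iff_uniqueDiffWithinAt]
          exact uniqueDiffOn_Icc zero_lt_one _ ht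
      have h2 : derivWithin (f ∘ γ) (Icc 0 1) t = dirDeriv f (γ t) (mfderivWithin 𝓘(ℝ, ℝ) (𝓡 n) γ (Icc 0 1) t 1) := by
        rw [← fderivWithin_derivWithin, ← mfderivWithin_eq_fderivWithin, h1]
        rfl
      rw [h2]
      exact hC t ht _
    _ = C * pathELength (𝓡 n) γ 0 1 := by
      rw [lintegral_const_mul' _ _ ENNReal.coe_ne_top, pathELength_eq_lintegral_mfderivWithin_Icc]

/-- The distance is the infimum of the lengths of curves, and a curve from `y` of length less than
`R` cannot leave the ball of radius `R`; so a derivative bound on that ball suffices. -/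
theorem norm_sub_le_of_dirDeriv_le [MetricSpace M] [ChartedSpace (𝔼 n) M]
    [RiemannianBundle (fun x : M => TangentSpace (𝓡 n) x)] [IsRiemannianManifold (𝓡 n) M]
    {f : M → E} {C R : ℝ} (hC0 : 0 ≤ C) {y y' : M} (hd : dist y y' < R)
    (hf : ∀ z ∈ Metric.ball y R, ContMDiffAt (𝓡 n) 𝓘(ℝ, E) 1 f z)
    (hC : ∀ z ∈ Metric.ball y R, ∀ v : TangentSpace (𝓡 n) z, ‖dirDeriv f z v‖ ≤ C * ‖v‖) :
    ‖f y' - f y‖ ≤ C * dist y y' := by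
  lift C to ℝ≥0 using hC0
  have key : ∀ r : ℝ, dist y y' < r → r ≤ R → ‖f y' - f y‖ ≤ C * r := by
    intro r hr hrR
    have hr' : riemannianEDist (𝓡 n) y y' < ENNReal.ofReal r := by
      rw [← IsRiemannianManifold.out, edist_dist]
      exact (ENNReal.ofReal_lt_ofReal_iff (dist_nonneg.trans_lt hr)).2 hr
    obtain ⟨γ, h0, h1, hγ, hlen, -⟩ :=
      exists_lt_locally_constant_of_riemannianEDist_lt hr' zero_lt_one
    have hmem : ∀ t ∈ Icc (0 : ℝ) 1, γ t ∈ Metric.ball y R := by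
      intro t ht
      have : edist y (γ t) < ENNReal.ofReal r := by
        rw [IsRiemannianManifold.out (I := 𝓡 n)]
        refine lt_of_le_of_lt ?_ hlen
        exact (riemannianEDist_le_pathELength hγ.contMDiffOn h0 rfl ht.1).trans
          (pathELength_mono le_rfl ht.2)
      rw [Metric.mem_ball, dist_comm]
      rw [edist_dist, ENNReal.ofReal_lt_ofReal_iff (dist_nonneg.trans_lt hr)] at this
      exact this.trans_le hrR
    have h := enorm_sub_le_mul_pathELength (f := f) (C := C) hγ (fun t ht => hf _ (hmem t ht))
      (fun t ht v => by
        have := hC _ (hmem t ht) v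
        rw [← ofReal_norm, ← ofReal_norm, ← ENNReal.ofReal_coe_nnreal,
          ← ENNReal.ofReal_mul C.coe_nonneg]
        exact ENNReal.ofReal_le_ofReal this)
    have h' : ‖f y' - f y‖ₑ ≤ C * ENNReal.ofReal r := by
      rw [← h0, ← h1]
      exact h.trans (mul_le_mul_right hlen.le _)
    rw [← ofReal_norm, ← ENNReal.ofReal_coe_nnreal, ← ENNReal.ofReal_mul C.coe_nonneg] at h'
    exact (ENNReal.ofReal_le_ofReal_iff (by have := dist_nonneg.trans_lt hr; positivity)).1 h'
  refine le_of_forall_pos_le_add fun ε hε => ?_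
  have hC1 : (0 : ℝ) < C + 1 := by positivity
  -- Dividing by `C + 1` instead of `C` covers `C = 0`.
  set r := min R (dist y y' + ε / (C + 1))
  have h1 : dist y y' < r := lt_min hd (by linarith [div_pos hε hC1])
  refine (key r h1 (min_le_left _ _)).trans ?_
  calc (C : ℝ) * r ≤ C * (dist y y' + ε / (C + 1)) := by
        gcongr; exact min_le_right _ _
    _ = C * dist y y' + C / (C + 1) * ε := by ring
    _ ≤ C * dist y y' + 1 * ε := by
        gcongr; rw [div_le_one hC1]; linarith
    _ = _ := by ring

end MeanValue

/-! ### Global vector fields and Lipschitz charts. -/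

section Frame

variable {n : ℕ} {M : Type*} [MetricSpace M] [ChartedSpace (𝔼 n) M] [IsManifold (𝓡 n) ∞ M]
  [RiemannianBundle (fun x : M => TangentSpace (𝓡 n) x)]
  [IsContMDiffRiemannianBundle (𝓡 n) ∞ (𝔼 n) (fun x : M => TangentSpace (𝓡 n) x)]


theorem isContinuousRiemannianBundle_tangent :
    IsContinuousRiemannianBundle (𝔼 n) (fun x : M => TangentSpace (𝓡 n) x) := by
  obtain ⟨g, hg, h⟩ := IsContMDiffRiemannianBundle.exists_contMDiff (IB := 𝓡 n) (n := ∞) (F := 𝔼 n)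
    (E := (fun x : M => TangentSpace (𝓡 n) x))
  exact ⟨g, hg.continuous, h⟩

/-- Near every point, tangent vectors are combinations with controlled coefficients of finitely
many globally defined smooth vector fields. -/
theorem exists_vectorFields_near (x₀ : M) :
    ∃ V : Fin n → ∀ x : M, TangentSpace (𝓡 n) x,
      (∀ i, ContMDiff (𝓡 n) (𝓡 n).tangent ∞
        (fun x => (⟨x, V i x⟩ : TangentBundle (𝓡 n) M))) ∧
      ∃ C : ℝ, 0 ≤ C ∧ ∀ᶠ z in 𝓝 x₀, ∀ v : TangentSpace (𝓡 n) z,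
        ∃ w : Fin n → ℝ, v = ∑ i, w i • V i z ∧ ∀ i, |w i| ≤ C * ‖v‖ := by
  have := isContinuousRiemannianBundle_tangent (n := n) (M := M)
  obtain ⟨C, hC0, hC⟩ := eventually_norm_trivializationAt_lt (𝔼 n)
    (fun x : M => TangentSpace (𝓡 n) x) x₀
  set e := trivializationAt (𝔼 n) (fun x : M => TangentSpace (𝓡 n) x) x₀ with he
  have hbase : e.baseSet = (chartAt (𝔼 n) x₀).source := TangentBundle.trivializationAt_baseSet x₀
  let b := (EuclideanSpace.basisFun (Fin n) ℝ).toBasis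
  let ψ : SmoothBumpFunction (𝓡 n) x₀ := Classical.choice inferInstance
  -- `IsDiffOp` admits only globally smooth fields, so the local frame is cut off by a bump function
  -- equal to 1 near `x₀`.
  refine ⟨fun i => (ψ : M → ℝ) • e.localFrame b i, fun i => ?_, C, hC0.le, ?_⟩
  · refine ContMDiffOn.smul_section_of_tsupport (u := e.baseSet) ψ.contMDiff.contMDiffOn
      e.open_baseSet ?_ (e.contMDiffOn_localFrame_baseSet ∞ b i)
    rw [hbase]
    exact ψ.tsupport_subset_chartAt_source
  · filter_upwards [hC, ψ.eventuallyEq_one, (chartAt (𝔼 n) x₀).open_source.mem_nhds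
      (mem_chart_source _ x₀)] with z hz hψ hzs v
    rw [← hbase] at hzs
    refine ⟨fun i => (e.continuousLinearMapAt ℝ z v) i, ?_, fun i => ?_⟩
    · have h1 : v = e.symmL ℝ z (e.continuousLinearMapAt ℝ z v) :=
        (e.symmL_continuousLinearMapAt hzs v).symm
      conv_lhs => rw [h1, ← b.sum_repr (e.continuousLinearMapAt ℝ z v), map_sum]
      refine Finset.sum_congr rfl fun i _ => ?_
      simp [hψ, hzs, Bundle.Trivialization.basisAt, b]
    · have h1 := (e.continuousLinearMapAt ℝ z).le_of_opNorm_le hz.le v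
      exact (PiLp.norm_apply_le (e.continuousLinearMapAt ℝ z v) i).trans h1

/-- A finite family of smooth vector fields controls the derivatives of all functions on a compact
Riemannian manifold. -/
theorem exists_vectorFields [CompactSpace M] (E : Type*) [NormedAddCommGroup E] [NormedSpace ℝ E] :
    ∃ (s : Finset M) (V : M → Fin n → ∀ x : M, TangentSpace (𝓡 n) x),
      (∀ p i, ContMDiff (𝓡 n) (𝓡 n).tangent ∞
        (fun x => (⟨x, V p i x⟩ : TangentBundle (𝓡 n) M))) ∧
      ∃ C : ℝ, 0 ≤ C ∧ ∀ (f : M → E) (z : M) (B : ℝ), 0 ≤ B →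
        (∀ p ∈ s, ∀ i, ‖dirDeriv f z (V p i z)‖ ≤ B) →
        ∀ v : TangentSpace (𝓡 n) z, ‖dirDeriv f z v‖ ≤ C * B * ‖v‖ := by
  choose V hV C hC0 hC using exists_vectorFields_near (n := n) (M := M)
  obtain ⟨s, hs⟩ := finite_cover_nhds hC
  refine ⟨s, V, hV, ∑ p ∈ s, n * C p,
    Finset.sum_nonneg fun p _ => mul_nonneg n.cast_nonneg (hC0 p), fun f z B hB h v => ?_⟩
  obtain ⟨p, hp, hz⟩ : ∃ p ∈ s, z ∈ {z | ∀ v : TangentSpace (𝓡 n) z,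
      ∃ w : Fin n → ℝ, v = ∑ i, w i • V p i z ∧ ∀ i, |w i| ≤ C p * ‖v‖} := by
    have : z ∈ (univ : Set M) := mem_univ z
    rw [← hs] at this
    simpa using this
  obtain ⟨w, hw, hwC⟩ := hz v
  have h1 : dirDeriv f z v = ∑ i, w i • dirDeriv f z (V p i z) := by
    conv_lhs => rw [hw]
    simp only [dirDeriv, map_sum, map_smul]
    rfl
  calc ‖dirDeriv f z v‖ ≤ ∑ i, ‖w i • dirDeriv f z (V p i z)‖ := by
        rw [h1]; exact norm_sum_le _ _
    _ ≤ ∑ _i : Fin n, C p * ‖v‖ * B := by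
        refine Finset.sum_le_sum fun i _ => ?_
        rw [norm_smul]
        exact mul_le_mul (hwC i) (h p hp i) (norm_nonneg _)
          (mul_nonneg (hC0 p) (norm_nonneg _))
    _ = n * C p * (B * ‖v‖) := by simp; ring
    _ ≤ (∑ p ∈ s, n * C p) * (B * ‖v‖) := by
        gcongr
        exact Finset.single_le_sum (f := fun p => (n : ℝ) * C p)
          (fun p _ => mul_nonneg n.cast_nonneg (hC0 p)) hp
    _ = _ := by ring

/-- Charts are locally Lipschitz with respect to the Riemannian distance. -/
theorem exists_lipschitz_chart [IsRiemannianManifold (𝓡 n) M] (x : M) :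
    ∃ r > 0, ∃ L : ℝ, 0 ≤ L ∧ Metric.ball x r ⊆ (chartAt (𝔼 n) x).source ∧
      ∀ y ∈ Metric.ball x r, ∀ z ∈ Metric.ball x r,
        dist (chartAt (𝔼 n) x y) (chartAt (𝔼 n) x z) ≤ L * dist y z := by
  have := isContinuousRiemannianBundle_tangent (n := n) (M := M)
  obtain ⟨C, hC0, hC⟩ := eventually_norm_trivializationAt_lt (𝔼 n)
    (fun x : M => TangentSpace (𝓡 n) x) x
  obtain ⟨r, hr, h⟩ := Metric.eventually_nhds_iff_ball.1 (hC.and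
    ((chartAt (𝔼 n) x).open_source.eventually_mem (mem_chart_source _ x)))
  -- Two points of the ball of radius `r / 3` are less than `2 * r / 3` apart, and the ball of that
  -- radius about either stays in `Metric.ball x r`, where the derivative of the chart is bounded.
  refine ⟨r / 3, by positivity, C, hC0.le,
    fun y hy => (h y (Metric.ball_subset_ball (by linarith) hy)).2, fun y hy z hz => ?_⟩
  rw [dist_comm, dist_eq_norm]
  have hyz : dist y z < 2 * r / 3 := by
    have := dist_triangle_right y z x
    rw [Metric.mem_ball] at hy hz
    linarith
  refine norm_sub_le_of_dirDeriv_le (n := n) hC0.le hyz (fun w hw => ?_) fun w hw v => ?_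
  all_goals
    have hwr : w ∈ Metric.ball x r := by
      rw [Metric.mem_ball] at *
      linarith [dist_triangle w y x]
  · have := contMDiffAt_extChartAt' (I := 𝓡 n) (n := 1) (h w hwr).2
    simpa using this
  · have h1 := (h w hwr).1
    rw [TangentBundle.continuousLinearMapAt_trivializationAt (h w hwr).2] at h1
    have h2 := ContinuousLinearMap.le_of_opNorm_le _ h1.le v
    exact h2

end Frame

/-! ### Gram determinants under linear maps. -/

section Gram

/-- The Gram determinant of the images of the standard basis transforms by the square of the
determinant under a linear change of coordinates. -/
theorem det_gram_comp {n : ℕ} {V : Type*} [NormedAddCommGroup V] [InnerProductSpace ℝ V]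
    (B : (𝔼 n) →ₗ[ℝ] V) (J : (𝔼 n) →L[ℝ] 𝔼 n) :
    (Matrix.of fun i j => inner ℝ (B (J (EuclideanSpace.single i (1 : ℝ))))
      (B (J (EuclideanSpace.single j (1 : ℝ)))) : Matrix (Fin n) (Fin n) ℝ).det =
    J.det ^ 2 * (Matrix.of fun i j => inner ℝ (B (EuclideanSpace.single i (1 : ℝ)))
      (B (EuclideanSpace.single j (1 : ℝ))) : Matrix (Fin n) (Fin n) ℝ).det := by
  let b := (EuclideanSpace.basisFun (Fin n) ℝ).toBasis
  let Jm : Matrix (Fin n) (Fin n) ℝ := LinearMap.toMatrix b b (J : (𝔼 n) →ₗ[ℝ] 𝔼 n)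
  have hJ : ∀ i, J (EuclideanSpace.single i (1 : ℝ)) =
      ∑ k, Jm k i • EuclideanSpace.single k (1 : ℝ) := by
    intro i
    have h := b.sum_repr (J (EuclideanSpace.single i (1 : ℝ)))
    simpa [Jm, LinearMap.toMatrix_apply, b] using h.symm
  have hdet : Jm.det = J.det := LinearMap.det_toMatrix b _
  have hmat : (Matrix.of fun i j => inner ℝ (B (J (EuclideanSpace.single i (1 : ℝ))))
      (B (J (EuclideanSpace.single j (1 : ℝ)))) : Matrix (Fin n) (Fin n) ℝ) =
      Jm.transpose * (Matrix.of fun i j => inner ℝ (B (EuclideanSpace.single i (1 : ℝ)))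
      (B (EuclideanSpace.single j (1 : ℝ))) : Matrix (Fin n) (Fin n) ℝ) * Jm := by
    ext i j
    simp only [Matrix.of_apply, Matrix.mul_apply, Matrix.transpose_apply, hJ, map_sum, map_smul,
      sum_inner, inner_sum, real_inner_smul_left, real_inner_smul_right, Finset.sum_mul]
    exact Finset.sum_congr rfl fun _ _ => Finset.sum_congr rfl fun _ _ => by ring
  rw [hmat, Matrix.det_mul, Matrix.det_mul, Matrix.det_transpose, hdet]
  ring

end Gram

/-! ### Riemannian volume of balls. -/

section Volume

variable {n : ℕ} {M : Type*} [MetricSpace M] [ChartedSpace (𝔼 n) M]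
  [RiemannianBundle (fun x : M => TangentSpace (𝓡 n) x)]

/-- The Gram matrix at `p` of the images of the standard basis under a linear map to the tangent
space at `p`. -/
noncomputable def tangentGram (p : M) (A : (𝔼 n) →L[ℝ] 𝔼 n) :
    Matrix (Fin n) (Fin n) ℝ :=
  Matrix.of fun i j =>
    @inner ℝ (TangentSpace (𝓡 n) p) _ (A (EuclideanSpace.single i (1 : ℝ)))
      (A (EuclideanSpace.single j (1 : ℝ)))

theorem chart_symm_eventuallyEq (x y : M) {u : 𝔼 n} (hu : u ∈ (chartAt (𝔼 n) x).target)
    (hy : (chartAt (𝔼 n) x).symm u ∈ (chartAt (𝔼 n) y).source) :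
    (chartAt (𝔼 n) x).symm =ᶠ[𝓝 u]
      (chartAt (𝔼 n) y).symm ∘ (chartAt (𝔼 n) y ∘ (chartAt (𝔼 n) x).symm) := by
  have h := ((chartAt (𝔼 n) x).symm.continuousAt hu).eventually
    ((chartAt (𝔼 n) y).open_source.mem_nhds hy)
  filter_upwards [h] with v hv
  simp [(chartAt (𝔼 n) y).left_inv hv]

variable [IsManifold (𝓡 n) ∞ M]

theorem differentiableAt_transition (x y : M) {u : 𝔼 n} (hu : u ∈ (chartAt (𝔼 n) x).target)
    (hy : (chartAt (𝔼 n) x).symm u ∈ (chartAt (𝔼 n) y).source) :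
    DifferentiableAt ℝ (chartAt (𝔼 n) y ∘ (chartAt (𝔼 n) x).symm) u := by
  rw [← mdifferentiableAt_iff_differentiableAt]
  exact (mdifferentiableAt_atlas (I := 𝓡 n) (chart_mem_atlas _ y) hy).comp u
    (mdifferentiableAt_atlas_symm (I := 𝓡 n) (chart_mem_atlas _ x) hu)

/-- By the chain rule the two coordinate frames differ by the Jacobian of the transition map. Its
square here becomes, under the square root, the absolute Jacobian of the change of variables
formula. -/
theorem det_metricMatrix_transition (x y : M) {u : 𝔼 n} (hu : u ∈ (chartAt (𝔼 n) x).target)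
    (hy : (chartAt (𝔼 n) x).symm u ∈ (chartAt (𝔼 n) y).source) :
    (metricMatrix n M x u).det =
      (fderiv ℝ (chartAt (𝔼 n) y ∘ (chartAt (𝔼 n) x).symm) u).det ^ 2 *
        (metricMatrix n M y (chartAt (𝔼 n) y ((chartAt (𝔼 n) x).symm u))).det := by
  set τ := chartAt (𝔼 n) y ∘ (chartAt (𝔼 n) x).symm with hτ
  have hτu : τ u ∈ (chartAt (𝔼 n) y).target := (chartAt (𝔼 n) y).map_source hy
  have hp : (chartAt (𝔼 n) y).symm (τ u) = (chartAt (𝔼 n) x).symm u :=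
    (chartAt (𝔼 n) y).left_inv hy
  have hd := differentiableAt_transition x y hu hy
  let Ax : (𝔼 n) →L[ℝ] 𝔼 n := mfderiv (𝓡 n) (𝓡 n) (chartAt (𝔼 n) x).symm u
  let Ay : (𝔼 n) →L[ℝ] 𝔼 n := mfderiv (𝓡 n) (𝓡 n) (chartAt (𝔼 n) y).symm (τ u)
  have hA : Ax = Ay ∘L fderiv ℝ τ u := by
    have h1 : Ax = mfderiv (𝓡 n) (𝓡 n) ((chartAt (𝔼 n) y).symm ∘ τ) u :=
      (chart_symm_eventuallyEq x y hu hy).mfderiv_eq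
    have h2 := mfderiv_comp u (I := 𝓡 n) (I' := 𝓡 n) (I'' := 𝓡 n)
      (mdifferentiableAt_atlas_symm (I := 𝓡 n) (chart_mem_atlas _ y) hτu) hd.mdifferentiableAt
    rw [h1, h2, mfderiv_eq_fderiv]
    rfl
  have hx : metricMatrix n M x u =
      tangentGram ((chartAt (𝔼 n) x).symm u) (Ay ∘L fderiv ℝ τ u) :=
    congrArg (fun A => tangentGram ((chartAt (𝔼 n) x).symm u) A) hA
  -- The base points agree only propositionally, so the tangent spaces are different types;
  -- `tangentGram` keeps the point as a separate argument that can be rewritten.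
  have hy' : metricMatrix n M y (τ u) = tangentGram ((chartAt (𝔼 n) x).symm u) Ay := by
    have : metricMatrix n M y (τ u) = tangentGram ((chartAt (𝔼 n) y).symm (τ u)) Ay := rfl
    rw [this]
    exact congrArg (fun p : M => tangentGram p Ay) hp
  change _ = _ * (metricMatrix n M y (τ u)).det
  rw [hx, hy']
  exact det_gram_comp (V := TangentSpace (𝓡 n) ((chartAt (𝔼 n) x).symm u)) Ay.toLinearMap
    (fderiv ℝ τ u)


theorem measurableSet_chart_target_inter [MeasurableSpace M] [BorelSpace M] (x : M) {A : Set M}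
    (hA : MeasurableSet A) :
    MeasurableSet ((chartAt (𝔼 n) x).target ∩ (chartAt (𝔼 n) x).symm ⁻¹' A) := by
  have h : Measurable ((chartAt (𝔼 n) x).target.domRestrict (chartAt (𝔼 n) x).symm) :=
    (continuousOn_iff_continuous_domRestrict.1 (chartAt (𝔼 n) x).symm.continuousOn).measurable
  have := (chartAt (𝔼 n) x).open_target.measurableSet.subtype_image (h hA)
  convert this using 1
  ext u
  simp [domRestrict, and_comm]

variable [MeasurableSpace M] [BorelSpace M]

theorem chartVolume_apply (x : M) {A : Set M} (hA : MeasurableSet A) :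
    chartVolume n M x A =
      ∫⁻ u in (chartAt (𝔼 n) x).target ∩ (chartAt (𝔼 n) x).symm ⁻¹' A,
        ENNReal.ofReal (Real.sqrt (metricMatrix n M x u).det) := by
  have hm : AEMeasurable (chartAt (𝔼 n) x).symm
      ((volume : Measure (𝔼 n)).restrict (chartAt (𝔼 n) x).target) :=
    (chartAt (𝔼 n) x).symm.continuousOn.aemeasurable (chartAt (𝔼 n) x).open_target.measurableSet
  rw [chartVolume, Measure.map_apply_of_aemeasurable
    (hm.mono_ac (withDensity_absolutelyContinuous _ _)) hA, withDensity_apply',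
    Measure.restrict_restrict' (chartAt (𝔼 n) x).open_target.measurableSet, inter_comm]

theorem chartVolume_inter_source (x : M) {A : Set M} (hA : MeasurableSet A) :
    chartVolume n M x A = chartVolume n M x (A ∩ (chartAt (𝔼 n) x).source) := by
  rw [chartVolume_apply x hA,
    chartVolume_apply x (hA.inter (chartAt (𝔼 n) x).open_source.measurableSet)]
  congr 2
  ext u
  simp only [mem_inter_iff, mem_preimage]
  exact ⟨fun h => ⟨h.1, h.2, (chartAt (𝔼 n) x).map_target h.1⟩, fun h => ⟨h.1, h.2.1⟩⟩

/-- The Riemannian volumes computed in two charts agree on the overlap of their domains. -/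
theorem chartVolume_eq_of_subset (x y : M) {A : Set M} (hA : MeasurableSet A)
    (hx : A ⊆ (chartAt (𝔼 n) x).source) (hy : A ⊆ (chartAt (𝔼 n) y).source) :
    chartVolume n M x A = chartVolume n M y A := by
  set φ := chartAt (𝔼 n) x
  set ψ := chartAt (𝔼 n) y
  set S := φ.target ∩ φ.symm ⁻¹' A
  have himg : ψ.target ∩ ψ.symm ⁻¹' A = (ψ ∘ φ.symm) '' S := by
    ext v
    constructor
    · rintro ⟨hv, hvA⟩
      refine ⟨φ (ψ.symm v), ⟨φ.map_source (hx hvA), ?_⟩, ?_⟩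
      · rw [mem_preimage, φ.left_inv (hx hvA)]; exact hvA
      · simp [φ.left_inv (hx hvA), ψ.right_inv hv]
    · rintro ⟨u, ⟨hu, huA⟩, rfl⟩
      refine ⟨ψ.map_source (hy huA), ?_⟩
      simpa [ψ.left_inv (hy huA)] using huA
  have hinj : InjOn (ψ ∘ φ.symm) S := by
    rintro u ⟨hu, huA⟩ v ⟨hv, hvA⟩ huv
    exact φ.symm.injOn hu hv (ψ.injOn (hy huA) (hy hvA) huv)
  rw [chartVolume_apply x hA, chartVolume_apply y hA, himg,
    lintegral_image_eq_lintegral_abs_det_fderiv_mul volume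
      (measurableSet_chart_target_inter x hA)
      (fun u hu => (differentiableAt_transition x y hu.1 (hy hu.2)).hasFDerivAt.hasFDerivWithinAt)
      hinj]
  refine setLIntegral_congr_fun (measurableSet_chart_target_inter x hA) fun u hu => ?_
  rw [det_metricMatrix_transition x y hu.1 (hy hu.2), Real.sqrt_mul (sq_nonneg _),
    Real.sqrt_sq_eq_abs, ENNReal.ofReal_mul (abs_nonneg _)]
  rfl

/-- Every chart measure lives on its chart domain and agrees with `chartVolume n M p` inside `U p`,
so the sum dominates each of them and hence their supremum. -/
theorem riemannianVolume_le_sum (s : Finset M) (U : M → Set M) (hU : ∀ p, MeasurableSet (U p))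
    (hUs : ∀ p, U p ⊆ (chartAt (𝔼 n) p).source) (hcover : ⋃ p ∈ s, U p = univ) :
    riemannianVolume n M ≤ ∑ p ∈ s, (chartVolume n M p).restrict (U p) := by
  refine iSup_le fun x => Measure.le_iff.2 fun A hA => ?_
  have hs := (chartAt (𝔼 n) x).open_source.measurableSet
  rw [chartVolume_inter_source x hA, Measure.finsetSum_apply]
  calc chartVolume n M x (A ∩ (chartAt (𝔼 n) x).source)
      ≤ chartVolume n M x (⋃ p ∈ s, A ∩ (chartAt (𝔼 n) x).source ∩ U p) := by
        refine measure_mono fun z hz => ?_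
        have : z ∈ ⋃ p ∈ s, U p := hcover ▸ mem_univ z
        simp only [mem_iUnion, exists_prop] at this ⊢
        obtain ⟨p, hp, hzp⟩ := this
        exact ⟨p, hp, hz, hzp⟩
    _ ≤ ∑ p ∈ s, chartVolume n M x (A ∩ (chartAt (𝔼 n) x).source ∩ U p) :=
        measure_biUnion_finset_le _ _
    _ ≤ ∑ p ∈ s, (chartVolume n M p).restrict (U p) A := by
        refine Finset.sum_le_sum fun p _ => ?_
        rw [chartVolume_eq_of_subset x p ((hA.inter hs).inter (hU p)) (fun z hz => hz.1.2)
          (fun z hz => hUs p hz.2), Measure.restrict_apply hA]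
        exact measure_mono fun z hz => ⟨hz.1.1, hz.2⟩

variable [IsContMDiffRiemannianBundle (𝓡 n) ∞ (𝔼 n) (fun x : M => TangentSpace (𝓡 n) x)]

/-- The Riemannian density of a chart is bounded near its centre. -/
theorem exists_density_le (x : M) :
    ∃ D : ℝ, ∀ᶠ z in 𝓝 x, Real.sqrt (metricMatrix n M x (chartAt (𝔼 n) x z)).det ≤ D := by
  have := isContinuousRiemannianBundle_tangent (n := n) (M := M)
  obtain ⟨C, hC0, hC⟩ := eventually_norm_symmL_trivializationAt_lt (𝔼 n)
    (fun x : M => TangentSpace (𝓡 n) x) x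
  refine ⟨Real.sqrt ((n.factorial : ℝ) * (C * C) ^ n), ?_⟩
  filter_upwards [hC, (chartAt (𝔼 n) x).open_source.eventually_mem (mem_chart_source _ x)]
    with z hz hzs
  refine Real.sqrt_le_sqrt ((le_abs_self _).trans ?_)
  have hvec : ∀ i, ‖coordVector n M x (chartAt (𝔼 n) x z) i‖ ≤ C := by
    intro i
    rw [TangentBundle.symmL_trivializationAt hzs] at hz
    have h2 := ContinuousLinearMap.le_of_opNorm_le _ hz.le (EuclideanSpace.single i (1 : ℝ))
    rw [show ‖EuclideanSpace.single i (1 : ℝ)‖ = 1 by simp, mul_one] at h2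
    have h3 : (chartAt (𝔼 n) x).symm (chartAt (𝔼 n) x z) = z := (chartAt (𝔼 n) x).left_inv hzs
    -- The norm depends on the base point, so the bound is carried along the equality `h3` of
    -- points.
    have h4 : ∀ p : M, p = z → @norm (TangentSpace (𝓡 n) p) _ (mfderivWithin (𝓡 n) (𝓡 n)
        (extChartAt (𝓡 n) x).symm (range (𝓡 n)) (extChartAt (𝓡 n) x z)
        (EuclideanSpace.single i (1 : ℝ))) ≤ C := by
      rintro p rfl
      exact h2
    have h5 : mfderivWithin (𝓡 n) (𝓡 n) (extChartAt (𝓡 n) x).symm (range (𝓡 n))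
        (extChartAt (𝓡 n) x z) = mfderiv (𝓡 n) (𝓡 n) (chartAt (𝔼 n) x).symm
          (chartAt (𝔼 n) x z) := by
      rw [modelWithCornersSelf_coe, range_id, mfderivWithin_univ]
      rfl
    have h6 := h4 _ h3
    rw [h5] at h6
    exact h6
  have h := Matrix.det_le (abv := AbsoluteValue.abs) (x := C * C)
    (A := metricMatrix n M x (chartAt (𝔼 n) x z)) fun i j =>
      (abs_real_inner_le_norm _ _).trans (mul_le_mul (hvec i) (hvec j) (norm_nonneg _) hC0.le)
  simpa using h

/-- The chart is Lipschitz near its centre, so a small piece of radius `ρ` has its coordinates in a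
Euclidean ball of radius `2 * L * ρ` about any one of its points, and the density there is at most
`D`. -/
theorem exists_chartVolume_ball_le [IsRiemannianManifold (𝓡 n) M] (x : M) :
    ∃ r > 0, Metric.ball x r ⊆ (chartAt (𝔼 n) x).source ∧ ∃ C : ℝ, 0 ≤ C ∧
      ∀ (z : M) (ρ : ℝ), 0 < ρ →
        chartVolume n M x (Metric.ball z ρ ∩ Metric.ball x r) ≤ ENNReal.ofReal (C * ρ ^ n) := by
  obtain ⟨r₁, hr₁, L, hL0, hsub, hL⟩ := exists_lipschitz_chart (n := n) x
  obtain ⟨D, hD⟩ := exists_density_le (n := n) x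
  obtain ⟨r₂, hr₂, hD⟩ := Metric.eventually_nhds_iff_ball.1 hD
  have hD0 : 0 ≤ D := (Real.sqrt_nonneg _).trans (hD x (Metric.mem_ball_self hr₂))
  have hvol : volume (Metric.ball (0 : 𝔼 n) 1) ≠ ⊤ := measure_ball_lt_top.ne
  refine ⟨min r₁ r₂, lt_min hr₁ hr₂, (Metric.ball_subset_ball (min_le_left _ _)).trans hsub,
    D * (2 * L) ^ n * (volume (Metric.ball (0 : 𝔼 n) 1)).toReal, by positivity,
    fun z ρ hρ => ?_⟩
  rw [chartVolume_apply x (Metric.isOpen_ball.inter Metric.isOpen_ball).measurableSet]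
  set φ := chartAt (𝔼 n) x
  set S := φ.target ∩ φ.symm ⁻¹' (Metric.ball z ρ ∩ Metric.ball x (min r₁ r₂)) with hS
  have hSm : MeasurableSet S := measurableSet_chart_target_inter x
    (Metric.isOpen_ball.inter Metric.isOpen_ball).measurableSet
  rcases S.eq_empty_or_nonempty with h | ⟨u₀, hu₀⟩
  · simp [h]
  have hSball : S ⊆ Metric.closedBall u₀ (2 * L * ρ) := by
    intro u hu
    have h1 := hL _ (Metric.ball_subset_ball (min_le_left _ _) hu.2.2) _
      (Metric.ball_subset_ball (min_le_left _ _) hu₀.2.2)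
    change dist (φ _) (φ _) ≤ _ at h1
    rw [φ.right_inv hu.1, φ.right_inv hu₀.1] at h1
    have h2 : dist (φ.symm u) (φ.symm u₀) ≤ 2 * ρ := by
      have h3 := Metric.mem_ball.1 hu.2.1
      have h4 := Metric.mem_ball.1 hu₀.2.1
      linarith [dist_triangle_right (φ.symm u) (φ.symm u₀) z]
    rw [Metric.mem_closedBall]
    calc dist u u₀ ≤ L * dist (φ.symm u) (φ.symm u₀) := h1
      _ ≤ L * (2 * ρ) := by gcongr
      _ = 2 * L * ρ := by ring
  calc ∫⁻ u in S, ENNReal.ofReal (Real.sqrt (metricMatrix n M x u).det)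
      ≤ ∫⁻ _ in S, ENNReal.ofReal D := by
        refine setLIntegral_mono' hSm fun u hu => ENNReal.ofReal_le_ofReal ?_
        have := hD _ (Metric.ball_subset_ball (min_le_right _ _) hu.2.2)
        change Real.sqrt (metricMatrix n M x (φ (φ.symm u))).det ≤ D at this
        rwa [φ.right_inv hu.1] at this
    _ = ENNReal.ofReal D * volume S := by simp
    _ ≤ ENNReal.ofReal D * volume (Metric.closedBall u₀ (2 * L * ρ)) := by gcongr
    _ = ENNReal.ofReal D * (ENNReal.ofReal ((2 * L * ρ) ^ n) *
          ENNReal.ofReal (volume (Metric.ball (0 : 𝔼 n) 1)).toReal) := by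
        rw [Measure.addHaar_closedBall _ _ (by positivity), finrank_euclideanSpace_fin,
          ENNReal.ofReal_toReal hvol]
    _ = _ := by
        rw [← ENNReal.ofReal_mul (by positivity), ← ENNReal.ofReal_mul hD0, mul_pow]
        ring_nf

/-- The Riemannian volume of balls of radius `r` in a compact manifold is `O(r ^ n)`. -/
theorem exists_riemannianVolume_ball_le [IsRiemannianManifold (𝓡 n) M] [CompactSpace M] :
    ∃ C : ℝ, 0 ≤ C ∧ ∀ (z : M) (ρ : ℝ), 0 < ρ →
      riemannianVolume n M (Metric.ball z ρ) ≤ ENNReal.ofReal (C * ρ ^ n) := by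
  choose r hr hsub C hC0 hC using exists_chartVolume_ball_le (n := n) (M := M)
  obtain ⟨s, hs⟩ := finite_cover_nhds fun x => Metric.ball_mem_nhds x (hr x)
  refine ⟨∑ p ∈ s, C p, Finset.sum_nonneg fun p _ => hC0 p, fun z ρ hρ => ?_⟩
  refine (riemannianVolume_le_sum s (fun p => Metric.ball p (r p))
    (fun p => Metric.isOpen_ball.measurableSet) hsub hs _).trans ?_
  rw [Measure.finsetSum_apply, Finset.sum_mul,
    ENNReal.ofReal_sum_of_nonneg fun p _ => mul_nonneg (hC0 p) (by positivity)]
  refine Finset.sum_le_sum fun p _ => ?_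
  rw [Measure.restrict_apply Metric.isOpen_ball.measurableSet]
  exact hC p z ρ hρ

theorem isFiniteMeasure_riemannianVolume [IsRiemannianManifold (𝓡 n) M] [CompactSpace M]
    [Nonempty M] : IsFiniteMeasure (riemannianVolume n M) := by
  obtain ⟨C, hC0, hC⟩ := exists_riemannianVolume_ball_le (n := n) (M := M)
  obtain ⟨R, hR, h⟩ := (isCompact_univ (X := M)).isBounded.subset_ball_lt 0 (Classical.arbitrary M)
  exact ⟨(measure_mono h).trans_lt ((hC _ R hR).trans_lt ENNReal.ofReal_lt_top)⟩

end Volume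

/-! ### Integrals against `dt / t`. -/

section LogMeasure

/-- The multiplicative Haar measure `dt / t` on the half-line `t > 0`. -/
noncomputable def logMeasure : Measure ℝ :=
  ((volume : Measure ℝ).restrict (Ioi 0)).withDensity fun t => ENNReal.ofReal t⁻¹

instance : SigmaFinite logMeasure :=
  SigmaFinite.withDensity_of_ne_top (Eventually.of_forall fun _ => ENNReal.ofReal_ne_top)

theorem ae_logMeasure_pos : ∀ᵐ t ∂logMeasure, 0 < t :=
  (withDensity_absolutelyContinuous _ _).ae_le (ae_restrict_mem measurableSet_Ioi)

theorem lintegral_logMeasure (f : ℝ → ℝ≥0∞) :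
    ∫⁻ t, f t ∂logMeasure = ∫⁻ t in Ioi (0 : ℝ), f t / ENNReal.ofReal t := by
  rw [logMeasure, lintegral_withDensity_eq_lintegral_mul_non_measurable _ (by fun_prop)
    (Eventually.of_forall fun _ => ENNReal.ofReal_lt_top)]
  refine setLIntegral_congr_fun measurableSet_Ioi fun t ht => ?_
  simp only [Pi.mul_apply]
  rw [ENNReal.ofReal_inv_of_pos ht, mul_comm, div_eq_mul_inv]

/-- Split at `t = d`. Below, the minimum is at most 1 and `∫ t^(α-1) = d^α / α` uses `0 < α`; above,
it is at most `d / t` and `d ∫ t^(α-2) = d^α / (1-α)` uses `α < 1`. -/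
theorem lintegral_logMeasure_rpow_min_le {α d : ℝ} (h0 : 0 < α) (h1 : α < 1) (hd : 0 ≤ d) :
    ∫⁻ t, ENNReal.ofReal (t ^ α * min 1 (d / t)) ∂logMeasure ≤
      ENNReal.ofReal ((α⁻¹ + (1 - α)⁻¹) * d ^ α) := by
  rw [lintegral_logMeasure]
  rcases hd.eq_or_lt with rfl | hd
  · simp
  have hA : IntegrableOn (fun t : ℝ => t ^ (α - 1)) (Ioc 0 d) := by
    rw [← intervalIntegrable_iff_integrableOn_Ioc_of_le hd.le]
    exact intervalIntegral.intervalIntegrable_rpow' (by linarith)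
  have hB : IntegrableOn (fun t : ℝ => t ^ (α - 2)) (Ioi d) :=
    integrableOn_Ioi_rpow_of_lt (by linarith) hd
  have hAv : ∫⁻ t in Ioc 0 d, ENNReal.ofReal (t ^ (α - 1)) = ENNReal.ofReal (α⁻¹ * d ^ α) := by
    rw [← ofReal_integral_eq_lintegral_ofReal hA
      ((ae_restrict_mem measurableSet_Ioc).mono fun t ht => Real.rpow_nonneg ht.1.le _),
      ← intervalIntegral.integral_of_le hd.le, integral_rpow (Or.inl (by linarith))]
    rw [sub_add_cancel, Real.zero_rpow h0.ne', sub_zero, div_eq_inv_mul]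
  have hBv : ∫⁻ t in Ioi d, ENNReal.ofReal (d * t ^ (α - 2)) =
      ENNReal.ofReal ((1 - α)⁻¹ * d ^ α) := by
    rw [← ofReal_integral_eq_lintegral_ofReal (hB.const_mul d)
      ((ae_restrict_mem measurableSet_Ioi).mono fun t ht =>
        mul_nonneg hd.le (Real.rpow_nonneg (hd.trans ht).le _)),
      integral_const_mul, integral_Ioi_rpow_of_lt (by linarith) hd]
    congr 1
    rw [show α - 2 + 1 = -(1 - α) by ring, Real.rpow_neg hd.le, Real.rpow_sub hd, Real.rpow_one]
    have : (1 - α) ≠ 0 := by linarith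
    have := (Real.rpow_pos_of_pos hd α).ne'
    field_simp
  rw [add_mul, ENNReal.ofReal_add (by positivity)
    (mul_nonneg (inv_nonneg.2 (by linarith)) (by positivity)), ← hAv, ← hBv,
    ← Ioc_union_Ioi_eq_Ioi hd.le]
  refine (lintegral_union_le _ _ _).trans (add_le_add ?_ ?_)
  · refine setLIntegral_mono' measurableSet_Ioc fun t ht => ?_
    rw [← ENNReal.ofReal_div_of_pos ht.1, Real.rpow_sub_one ht.1.ne']
    refine ENNReal.ofReal_le_ofReal (div_le_div_of_nonneg_right ?_ ht.1.le)
    exact mul_le_of_le_one_right (Real.rpow_nonneg ht.1.le _) (min_le_left _ _)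
  · refine setLIntegral_mono' measurableSet_Ioi fun t ht => ?_
    have ht0 : 0 < t := hd.trans ht
    rw [← ENNReal.ofReal_div_of_pos ht0]
    refine ENNReal.ofReal_le_ofReal ?_
    calc t ^ α * min 1 (d / t) / t ≤ t ^ α * (d / t) / t := by
          gcongr; exact min_le_right _ _
      _ = d * t ^ (α - 2) := by
          rw [Real.rpow_sub ht0, Real.rpow_two]; field_simp

theorem integrable_logMeasure_rpow_min {α d : ℝ} (h0 : 0 < α) (h1 : α < 1) (hd : 0 ≤ d) :
    Integrable (fun t : ℝ => t ^ α * min 1 (d / t)) logMeasure := by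
  refine ⟨by fun_prop, ?_⟩
  rw [hasFiniteIntegral_iff_ofReal]
  · exact (lintegral_logMeasure_rpow_min_le h0 h1 hd).trans_lt ENNReal.ofReal_lt_top
  · filter_upwards [ae_logMeasure_pos] with t ht
    exact mul_nonneg (Real.rpow_nonneg ht.le _) (le_min zero_le_one (by positivity))

theorem integral_logMeasure_rpow_min_le {α d : ℝ} (h0 : 0 < α) (h1 : α < 1) (hd : 0 ≤ d) :
    ∫ t, t ^ α * min 1 (d / t) ∂logMeasure ≤ (α⁻¹ + (1 - α)⁻¹) * d ^ α := by
  have hα : 0 < 1 - α := by linarith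
  rw [integral_eq_lintegral_of_nonneg_ae _ (by fun_prop)]
  · exact ENNReal.toReal_le_of_le_ofReal (by positivity)
      (lintegral_logMeasure_rpow_min_le h0 h1 hd)
  · filter_upwards [ae_logMeasure_pos] with t ht
    exact mul_nonneg (Real.rpow_nonneg ht.le _) (le_min zero_le_one (by positivity))

end LogMeasure

/-! ### Uniform integrability of the decay weight. -/

section DecayWeight

variable {X : Type*} [MetricSpace X]

/-- The weight `t⁻ⁿ (1 + d(x, y) / t)⁻⁽ⁿ⁺¹⁾`. -/
noncomputable def decayWeight (n : ℕ) (t : ℝ) (x y : X) : ℝ :=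
  ((1 + dist x y / t) ^ (n + 1))⁻¹ / t ^ n

theorem decayWeight_nonneg {n : ℕ} {t : ℝ} (ht : 0 < t) (x y : X) : 0 ≤ decayWeight n t x y := by
  unfold decayWeight; positivity

theorem decayWeight_comm {n : ℕ} {t : ℝ} (x y : X) : decayWeight n t x y = decayWeight n t y x := by
  rw [decayWeight, decayWeight, dist_comm]

theorem decayWeight_le {n : ℕ} {t : ℝ} (ht : 0 < t) (x y : X) :
    decayWeight n t x y ≤ (t ^ n)⁻¹ := by
  rw [decayWeight, div_eq_mul_inv]
  have : 0 ≤ dist x y / t := by positivity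
  exact mul_le_of_le_one_left (by positivity)
    (inv_le_one_of_one_le₀ (one_le_pow₀ (by linarith)))

variable [MeasurableSpace X] [BorelSpace X] {μ : Measure X} [IsFiniteMeasure μ]

/-- On the dyadic shell `2^k ≤ 1 + d/t < 2^(k+1)` the weight is at most `2^(-k(n+1)) t⁻ⁿ`, while the
enclosing ball has volume at most `A (2^(k+1) t)ⁿ`. The product is `A 2ⁿ 2⁻ᵏ`, a geometric series.
-/
theorem lintegral_decayWeight_le {n : ℕ} {A : ℝ} (hA : 0 ≤ A)
    (hμ : ∀ (z : X) (ρ : ℝ), 0 < ρ → μ (Metric.ball z ρ) ≤ ENNReal.ofReal (A * ρ ^ n))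
    {t : ℝ} (ht : 0 < t) (x : X) :
    ∫⁻ y, ENNReal.ofReal (decayWeight n t x y) ∂μ ≤ ENNReal.ofReal (A * 2 ^ n * 2) := by
  let c : ℕ → ℝ := fun k => ((2 ^ k) ^ (n + 1))⁻¹ / t ^ n
  let f : ℕ → X → ℝ≥0∞ := fun k =>
    (Metric.ball x (2 ^ (k + 1) * t)).indicator fun _ => ENNReal.ofReal (c k)
  have hle : ∀ y, ENNReal.ofReal (decayWeight n t x y) ≤ ∑' k, f k y := by
    intro y
    have h0 : 0 ≤ dist x y / t := by positivity
    obtain ⟨k, hk1, hk2⟩ := exists_nat_pow_near (x := 1 + dist x y / t) (y := 2)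
      (by linarith) one_lt_two
    refine le_trans ?_ (ENNReal.le_tsum k)
    have hy : y ∈ Metric.ball x (2 ^ (k + 1) * t) := by
      rw [Metric.mem_ball, dist_comm, ← div_lt_iff₀ ht]
      linarith
    simp only [f, indicator_of_mem hy]
    refine ENNReal.ofReal_le_ofReal ?_
    unfold decayWeight c
    gcongr
  calc ∫⁻ y, ENNReal.ofReal (decayWeight n t x y) ∂μ ≤ ∫⁻ y, ∑' k, f k y ∂μ := lintegral_mono hle
    _ = ∑' k, ∫⁻ y, f k y ∂μ := lintegral_tsum fun k =>
        (measurable_const.indicator Metric.isOpen_ball.measurableSet).aemeasurable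
    _ ≤ ∑' k : ℕ, ENNReal.ofReal (A * 2 ^ n * (1 / 2) ^ k) := by
        refine ENNReal.tsum_le_tsum fun k => ?_
        simp only [f, lintegral_indicator_const Metric.isOpen_ball.measurableSet]
        refine (mul_le_mul_right (hμ x (2 ^ (k + 1) * t) (by positivity)) _).trans ?_
        rw [← ENNReal.ofReal_mul (by positivity)]
        refine ENNReal.ofReal_le_ofReal (le_of_eq ?_)
        simp only [c, mul_pow, pow_succ, one_div, inv_pow]
        field_simp
    _ = ENNReal.ofReal (A * 2 ^ n * 2) := by
        rw [← ENNReal.ofReal_tsum_of_nonneg (fun k => by positivity)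
          (summable_geometric_two.mul_left _), tsum_mul_left, tsum_geometric_two]

theorem integrable_decayWeight {n : ℕ} {t : ℝ} (ht : 0 < t) (x : X) :
    Integrable (fun y => decayWeight n t x y) μ := by
  have hm : AEStronglyMeasurable (fun y => decayWeight n t x y) μ := by
    refine (Measurable.aestronglyMeasurable ?_)
    unfold decayWeight
    have : Measurable fun y => dist x y := (continuous_const.dist continuous_id).measurable
    fun_prop
  refine (integrable_const ((t ^ n)⁻¹)).mono' hm (Eventually.of_forall fun y => ?_)
  rw [Real.norm_of_nonneg (decayWeight_nonneg ht x y)]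
  exact decayWeight_le ht x y

theorem integral_decayWeight_le {n : ℕ} {A : ℝ} (hA : 0 ≤ A)
    (hμ : ∀ (z : X) (ρ : ℝ), 0 < ρ → μ (Metric.ball z ρ) ≤ ENNReal.ofReal (A * ρ ^ n))
    {t : ℝ} (ht : 0 < t) (x : X) :
    ∫ y, decayWeight n t x y ∂μ ≤ A * 2 ^ n * 2 := by
  rw [integral_eq_lintegral_of_nonneg_ae
    (Eventually.of_forall fun y => decayWeight_nonneg ht x y)
    (integrable_decayWeight ht x).aestronglyMeasurable]
  exact ENNReal.toReal_le_of_le_ofReal (by positivity) (lintegral_decayWeight_le hA hμ ht x)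

end DecayWeight

/-! ### Polarization of an isometry in `L²`. -/

section Polarization

variable {X Y : Type*} [MeasurableSpace X] [MeasurableSpace Y] {μ : Measure X} {ρ : Measure Y}

theorem integrable_star_mul {f g : X → ℂ} (hf : MemLp f 2 μ) (hg : MemLp g 2 μ) :
    Integrable (fun x => star (f x) * g x) μ :=
  hf.star.integrable_mul hg

theorem integral_norm_add_sq {f g : X → ℂ} (hf : MemLp f 2 μ) (hg : MemLp g 2 μ) :
    ∫ x, ‖f x + g x‖ ^ 2 ∂μ =
      ∫ x, ‖f x‖ ^ 2 ∂μ + ∫ x, ‖g x‖ ^ 2 ∂μ + 2 * (∫ x, star (f x) * g x ∂μ).re := by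
  have hre : (∫ x, star (f x) * g x ∂μ).re = ∫ x, (star (f x) * g x).re ∂μ :=
    (integral_re (integrable_star_mul hf hg)).symm
  have h1 := hf.integrable_norm_pow two_ne_zero
  have h2 := hg.integrable_norm_pow two_ne_zero
  have h3 : Integrable (fun x => (star (f x) * g x).re) μ := (integrable_star_mul hf hg).re
  have h12 : Integrable (fun x => ‖f x‖ ^ 2 + ‖g x‖ ^ 2) μ := h1.add h2
  rw [hre, ← integral_const_mul, ← integral_add h1 h2, ← integral_add h12 (h3.const_mul 2)]
  refine integral_congr_ae (Eventually.of_forall fun x => ?_)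
  simp only [← Complex.normSq_eq_norm_sq, Complex.normSq_apply]
  simp
  ring

/-- Real parts suffice for the reconstruction, so the isometry is needed only for two functions and
their sum. -/
theorem re_integral_star_mul_eq_of_isometry {c : ℝ} {f₁ f₂ : Y → ℂ} {g₁ g₂ : X → ℂ}
    (hf₁ : MemLp f₁ 2 ρ) (hf₂ : MemLp f₂ 2 ρ) (hg₁ : MemLp g₁ 2 μ) (hg₂ : MemLp g₂ 2 μ)
    (h₁ : ∫ y, ‖f₁ y‖ ^ 2 ∂ρ = c * ∫ x, ‖g₁ x‖ ^ 2 ∂μ)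
    (h₂ : ∫ y, ‖f₂ y‖ ^ 2 ∂ρ = c * ∫ x, ‖g₂ x‖ ^ 2 ∂μ)
    (h₁₂ : ∫ y, ‖f₁ y + f₂ y‖ ^ 2 ∂ρ = c * ∫ x, ‖g₁ x + g₂ x‖ ^ 2 ∂μ) :
    (∫ y, star (f₁ y) * f₂ y ∂ρ).re = c * (∫ x, star (g₁ x) * g₂ x ∂μ).re := by
  rw [integral_norm_add_sq hf₁ hf₂, integral_norm_add_sq hg₁ hg₂, h₁, h₂] at h₁₂
  linarith

end Polarization

/-! ### Decaying kernels: part (a), and regularity of the adjoint transform. -/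

section Kernel

variable {X : Type*} [MetricSpace X] [MeasurableSpace X] [BorelSpace X]

/-- Size and regularity bounds for a family of kernels `K_t(x, y)` on an `n`-dimensional space. -/
structure IsDecayingKernel (n : ℕ) (B : ℝ) (K : ℝ → X → X → ℂ) : Prop where
  measurable : Measurable fun p : (ℝ × X) × X => K p.1.1 p.1.2 p.2
  nonneg : 0 ≤ B
  -- The factor `1 + dist x y / t` is the spare power that absorbs `d^α` for `α ≤ 1`.
  norm_le : ∀ t : ℝ, 0 < t → ∀ x y, (1 + dist x y / t) * ‖K t x y‖ ≤ B * decayWeight n t x y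
  norm_sub_le : ∀ t : ℝ, 0 < t → ∀ x y y', dist y y' ≤ t →
    ‖K t x y' - K t x y‖ ≤ B * (dist y y' / t) * decayWeight n t x y

namespace IsDecayingKernel

variable {n : ℕ} {B A : ℝ} {K : ℝ → X → X → ℂ} {μ : Measure X}

theorem norm_le_weight (hK : IsDecayingKernel n B K) {t : ℝ} (ht : 0 < t) (x y : X) :
    ‖K t x y‖ ≤ B * decayWeight n t x y := by
  refine le_trans ?_ (hK.norm_le t ht x y)
  have : 0 ≤ dist x y / t := by positivity
  exact le_mul_of_one_le_left (norm_nonneg _) (by linarith)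

theorem norm_le_const (hK : IsDecayingKernel n B K) {t : ℝ} (ht : 0 < t) (x y : X) :
    ‖K t x y‖ ≤ B * (t ^ n)⁻¹ :=
  (hK.norm_le_weight ht x y).trans (mul_le_mul_of_nonneg_left (decayWeight_le ht x y) hK.nonneg)

theorem measurable_right (hK : IsDecayingKernel n B K) (t : ℝ) (x : X) :
    Measurable fun y => K t x y :=
  hK.measurable.comp (measurable_prodMk_left (x := (t, x)))

theorem measurable_left (hK : IsDecayingKernel n B K) (t : ℝ) (y : X) :
    Measurable fun x => K t x y := by
  have h : Measurable fun x : X => ((t, x), y) := by fun_prop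
  exact hK.measurable.comp h

theorem integrable_mul (hK : IsDecayingKernel n B K) {t : ℝ} (ht : 0 < t) (x : X) {F : X → ℂ}
    (hF : Integrable F μ) : Integrable (fun y => K t x y * F y) μ :=
  hF.bdd_mul (hK.measurable_right t x).aestronglyMeasurable
    (Eventually.of_forall fun y => hK.norm_le_const ht x y)

variable [IsFiniteMeasure μ]

/-- Hölder continuity of `F` implies decay of its wavelet transform at small scales. -/
theorem norm_integral_le_of_holder (hK : IsDecayingKernel n B K) (hA : 0 ≤ A)
    (hμ : ∀ (z : X) (ρ : ℝ), 0 < ρ → μ (Metric.ball z ρ) ≤ ENNReal.ofReal (A * ρ ^ n))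
    {F : X → ℂ} (hF : Integrable F μ) {α C : ℝ} (hα0 : 0 ≤ α) (hα1 : α ≤ 1) (hC : 0 ≤ C)
    (hH : ∀ x y, ‖F y - F x‖ ≤ C * dist x y ^ α) {t : ℝ} (ht : 0 < t) (x : X)
    (h0 : ∫ y, K t x y ∂μ = 0) :
    ‖∫ y, K t x y * F y ∂μ‖ ≤ B * C * (A * 2 ^ n * 2) * t ^ α := by
  have hi1 : Integrable (fun y => K t x y) μ := by
    simpa using hK.integrable_mul ht x (integrable_const (1 : ℂ))
  have heq : ∫ y, K t x y * F y ∂μ = ∫ y, K t x y * (F y - F x) ∂μ := by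
    simp_rw [mul_sub]
    rw [integral_sub (hK.integrable_mul ht x hF) (hi1.mul_const _), integral_mul_const, h0]
    simp
  -- Since `α ≤ 1`, the power `(d/t)^α` is at most `1 + d/t`.
  have hd : ∀ y, dist x y ^ α ≤ t ^ α * (1 + dist x y / t) := by
    intro y
    have h1 : 0 ≤ dist x y / t := by positivity
    calc dist x y ^ α = (t * (dist x y / t)) ^ α := by rw [mul_div_cancel₀ _ ht.ne']
      _ = t ^ α * (dist x y / t) ^ α := Real.mul_rpow ht.le h1
      _ ≤ t ^ α * (1 + dist x y / t) := by
        gcongr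
        calc (dist x y / t) ^ α ≤ (1 + dist x y / t) ^ α := by gcongr; linarith
          _ ≤ (1 + dist x y / t) ^ (1 : ℝ) := Real.rpow_le_rpow_of_exponent_le (by linarith) hα1
          _ = _ := Real.rpow_one _
  rw [heq]
  calc ‖∫ y, K t x y * (F y - F x) ∂μ‖ ≤ ∫ y, B * C * t ^ α * decayWeight n t x y ∂μ := by
        refine norm_integral_le_of_norm_le ((integrable_decayWeight ht x).const_mul _)
          (Eventually.of_forall fun y => ?_)
        rw [norm_mul]
        calc ‖K t x y‖ * ‖F y - F x‖ ≤ ‖K t x y‖ * (C * (t ^ α * (1 + dist x y / t))) := by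
              gcongr
              exact (hH x y).trans (by gcongr; exact hd y)
          _ = C * t ^ α * ((1 + dist x y / t) * ‖K t x y‖) := by ring
          _ ≤ C * t ^ α * (B * decayWeight n t x y) := by
              exact mul_le_mul_of_nonneg_left (hK.norm_le t ht x y) (by positivity)
          _ = _ := by ring
    _ = B * C * t ^ α * ∫ y, decayWeight n t x y ∂μ := integral_const_mul _ _
    _ ≤ B * C * t ^ α * (A * 2 ^ n * 2) := by
        have := hK.nonneg
        gcongr
        exact integral_decayWeight_le hA hμ ht x
    _ = _ := by ring

end IsDecayingKernel

/-- The wavelet transform `∫ K_t(x, y) F(y) dμ(y)`. -/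
noncomputable def transform (μ : Measure X) (K : ℝ → X → X → ℂ) (F : X → ℂ) (t : ℝ) (x : X) : ℂ :=
  ∫ y, K t x y * F y ∂μ

/-- The adjoint transform `∫ conj (S_t(x)) K_t(x, y) dμ(x)` of a function `S` of scale and
position, before integration in the scale. -/
noncomputable def cotransform (μ : Measure X) (K : ℝ → X → X → ℂ) (S : ℝ → X → ℂ) (t : ℝ) (y : X) :
    ℂ :=
  ∫ x, star (S t x) * K t x y ∂μ

namespace IsDecayingKernel

variable {n : ℕ} {B A : ℝ} {K : ℝ → X → X → ℂ} {μ : Measure X} [IsFiniteMeasure μ]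

theorem measurable_transform (hK : IsDecayingKernel n B K) {F : X → ℂ} (hF : Measurable F) :
    Measurable (Function.uncurry (transform μ K F)) := by
  have h : StronglyMeasurable fun p : (ℝ × X) × X => K p.1.1 p.1.2 p.2 * F p.2 :=
    (hK.measurable.mul (hF.comp measurable_snd)).stronglyMeasurable
  exact h.integral_prod_right'.measurable

theorem measurable_cotransform (hK : IsDecayingKernel n B K) {S : ℝ → X → ℂ}
    (hS : Measurable (Function.uncurry S)) :
    Measurable (Function.uncurry (cotransform μ K S)) := by
  have h1 : Measurable fun p : (ℝ × X) × X => ((p.1.1, p.2), p.1.2) := by fun_prop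
  have h2 : Measurable fun p : (ℝ × X) × X => (p.1.1, p.2) := by fun_prop
  have h3 : Measurable fun p : (ℝ × X) × X => star (S p.1.1 p.2) :=
    continuous_star.measurable.comp (hS.comp h2)
  have h : StronglyMeasurable fun p : (ℝ × X) × X => star (S p.1.1 p.2) * K p.1.1 p.2 p.1.2 :=
    (h3.mul (hK.measurable.comp h1)).stronglyMeasurable
  exact h.integral_prod_right'.measurable

theorem transform_add (hK : IsDecayingKernel n B K) {F G : X → ℂ} (hF : Integrable F μ)
    (hG : Integrable G μ) {t : ℝ} (ht : 0 < t) (x : X) :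
    transform μ K (F + G) t x = transform μ K F t x + transform μ K G t x := by
  simp only [transform, Pi.add_apply, mul_add]
  exact integral_add (hK.integrable_mul ht x hF) (hK.integrable_mul ht x hG)

/-- Regularity of the adjoint transform of a function bounded by `a` at scale `t`. -/
theorem norm_cotransform_sub_le (hK : IsDecayingKernel n B K) (hA : 0 ≤ A)
    (hμ : ∀ (z : X) (ρ : ℝ), 0 < ρ → μ (Metric.ball z ρ) ≤ ENNReal.ofReal (A * ρ ^ n))
    {S : ℝ → X → ℂ} {t a : ℝ} (ht : 0 < t) (hSm : Measurable (S t)) (ha : 0 ≤ a)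
    (hS : ∀ x, ‖S t x‖ ≤ a) (y y' : X) :
    ‖cotransform μ K S t y' - cotransform μ K S t y‖ ≤
      a * (2 * B * (A * 2 ^ n * 2)) * min 1 (dist y y' / t) := by
  have hB := hK.nonneg
  have hint : ∀ y, Integrable (fun x => star (S t x) * K t x y) μ := fun y =>
    (integrable_const (a * (B * (t ^ n)⁻¹))).mono'
      ((continuous_star.measurable.comp hSm).mul (hK.measurable_left t y)).aestronglyMeasurable
      (Eventually.of_forall fun x => by
        rw [norm_mul, norm_star]
        exact mul_le_mul (hS x) (hK.norm_le_const ht x y) (norm_nonneg _) ha)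
  have hw : ∀ y, ∫ x, decayWeight n t x y ∂μ ≤ A * 2 ^ n * 2 := fun y => by
    simp_rw [fun x => decayWeight_comm (n := n) (t := t) x y]
    exact integral_decayWeight_le hA hμ ht y
  have hwi : ∀ y, Integrable (fun x => decayWeight n t x y) μ := fun y => by
    simp_rw [fun x => decayWeight_comm (n := n) (t := t) x y]
    exact integrable_decayWeight ht y
  have hsz : ∀ y, ‖cotransform μ K S t y‖ ≤ a * (B * (A * 2 ^ n * 2)) := by
    intro y
    calc ‖cotransform μ K S t y‖ ≤ ∫ x, a * (B * decayWeight n t x y) ∂μ := by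
          refine norm_integral_le_of_norm_le (((hwi y).const_mul B).const_mul a)
            (Eventually.of_forall fun x => ?_)
          rw [norm_mul, norm_star]
          exact mul_le_mul (hS x) (hK.norm_le_weight ht x y) (norm_nonneg _) ha
      _ = a * (B * ∫ x, decayWeight n t x y ∂μ) := by
          rw [integral_const_mul, integral_const_mul]
      _ ≤ _ := by gcongr; exact hw y
  -- Within scale `t` the Lipschitz bound on the kernel applies; beyond it each term is estimated by
  -- size, which is where the factor 2 comes from.
  rcases le_total (dist y y') t with h | h
  · rw [min_eq_right ((div_le_one ht).2 h)]
    have hdt : 0 ≤ dist y y' / t := by positivity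
    calc ‖cotransform μ K S t y' - cotransform μ K S t y‖
        = ‖∫ x, star (S t x) * (K t x y' - K t x y) ∂μ‖ := by
          simp_rw [mul_sub]
          rw [integral_sub (hint y') (hint y)]
          rfl
      _ ≤ ∫ x, a * (B * (dist y y' / t) * decayWeight n t x y) ∂μ := by
          refine norm_integral_le_of_norm_le (((hwi y).const_mul _).const_mul a)
            (Eventually.of_forall fun x => ?_)
          rw [norm_mul, norm_star]
          exact mul_le_mul (hS x) (hK.norm_sub_le t ht x y y' h) (norm_nonneg _) ha
      _ = a * (B * (dist y y' / t) * ∫ x, decayWeight n t x y ∂μ) := by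
          rw [integral_const_mul, integral_const_mul]
      _ ≤ a * (B * (dist y y' / t) * (A * 2 ^ n * 2)) := by gcongr; exact hw y
      _ = a * (1 * B * (A * 2 ^ n * 2)) * (dist y y' / t) := by ring
      _ ≤ _ := by gcongr; norm_num
  · rw [min_eq_left ((one_le_div ht).2 h)]
    refine (_root_.norm_sub_le _ _).trans ((add_le_add (hsz y') (hsz y)).trans (le_of_eq ?_))
    ring

end IsDecayingKernel

end Kernel

/-! ### Conversions of integrals and Hölder bounds. -/

section Auxiliary

theorem integral_norm_sq_eq_toReal {Y : Type*} [MeasurableSpace Y] {ρ : Measure Y} {f : Y → ℂ}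
    (hf : AEStronglyMeasurable f ρ) :
    ∫ y, ‖f y‖ ^ 2 ∂ρ = (∫⁻ y, ‖f y‖ₑ ^ 2 ∂ρ).toReal := by
  have hm : AEStronglyMeasurable (fun y => ‖f y‖ ^ 2) ρ := hf.norm.pow 2
  rw [integral_eq_lintegral_of_nonneg_ae (Eventually.of_forall fun y => by simp) hm]
  congr 1
  refine lintegral_congr fun y => ?_
  rw [ENNReal.ofReal_pow (norm_nonneg _), ofReal_norm]

theorem holderWith_of_norm_sub_le {X E : Type*} [PseudoMetricSpace X] [SeminormedAddCommGroup E]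
    {f : X → E} {C : ℝ} {α : ℝ≥0} (hC : 0 ≤ C)
    (h : ∀ x y, ‖f y - f x‖ ≤ C * dist x y ^ (α : ℝ)) : HolderWith C.toNNReal α f := by
  intro x y
  rw [edist_dist, edist_dist, dist_comm (f x), dist_eq_norm,
    ENNReal.ofReal_rpow_of_nonneg dist_nonneg α.coe_nonneg]
  change _ ≤ ENNReal.ofReal C * _
  rw [← ENNReal.ofReal_mul hC]
  exact ENNReal.ofReal_le_ofReal (h x y)

end Auxiliary

/-! ### Part (b): reconstruction of `F` from its transform. -/

section Reconstruction

variable {X : Type*} [MetricSpace X] [MeasurableSpace X] [BorelSpace X] [CompactSpace X]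

namespace IsDecayingKernel

variable {n : ℕ} {B A : ℝ} {K : ℝ → X → X → ℂ} {μ : Measure X} [IsFiniteMeasure μ]

theorem memLp_transform (hK : IsDecayingKernel n B K) {F : X → ℂ} (hF : Measurable F)
    (hfin : ∫⁻ t, ∫⁻ x, ‖transform μ K F t x‖ₑ ^ 2 ∂μ ∂logMeasure ≠ ⊤) :
    MemLp (Function.uncurry (transform μ K F)) 2 (logMeasure.prod μ) := by
  have hm : Measurable (Function.uncurry (transform μ K F)) := hK.measurable_transform hF
  refine ⟨hm.aestronglyMeasurable, ?_⟩
  rw [eLpNorm_lt_top_iff_lintegral_rpow_enorm_lt_top two_ne_zero ENNReal.ofNat_ne_top]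
  simp only [ENNReal.toReal_ofNat, ENNReal.rpow_two]
  rw [lintegral_prod _ (hm.enorm.pow_const 2).aemeasurable]
  exact hfin.lt_top

theorem integral_norm_sq_transform (hK : IsDecayingKernel n B K) {F : X → ℂ} (hF : Measurable F)
    {c : ℝ} (hc : 0 ≤ c) {G : X → ℂ} (hG : MemLp G 2 μ)
    (h : ∫⁻ t, ∫⁻ x, ‖transform μ K F t x‖ₑ ^ 2 ∂μ ∂logMeasure =
      ENNReal.ofReal c * ∫⁻ x, ‖G x‖ₑ ^ 2 ∂μ) :
    ∫ p, ‖Function.uncurry (transform μ K F) p‖ ^ 2 ∂(logMeasure.prod μ) =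
      c * ∫ x, ‖G x‖ ^ 2 ∂μ := by
  have hm : Measurable (Function.uncurry (transform μ K F)) := hK.measurable_transform hF
  rw [integral_norm_sq_eq_toReal hm.aestronglyMeasurable, integral_norm_sq_eq_toReal hG.1,
    lintegral_prod _ (hm.enorm.pow_const 2).aemeasurable]
  simp only [Function.uncurry_apply_pair]
  rw [h, ENNReal.toReal_mul, ENNReal.toReal_ofReal hc]

variable {F H : X → ℂ} {α a c : ℝ}

/-- Moving the transform in the second factor to the first one. -/
theorem integral_star_transform_mul (hK : IsDecayingKernel n B K) (hFm : Measurable F)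
    (hHi : Integrable H μ) {t : ℝ} (ht : 0 < t)
    (hS : ∀ x, ‖transform μ K F t x‖ ≤ a) (z : ℂ) (h0 : ∫ y, H y ∂μ = 0) :
    ∫ x, star (transform μ K F t x) * transform μ K H t x ∂μ =
      ∫ y, (cotransform μ K (transform μ K F) t y - z) * H y ∂μ := by
  have hSm : Measurable (transform μ K F t) :=
    (hK.measurable_transform hFm).comp measurable_prodMk_left
  have hSs : Measurable fun x => star (transform μ K F t x) := continuous_star.measurable.comp hSm
  have hKm : Measurable fun p : X × X => K t p.1 p.2 := by
    have h : Measurable fun p : X × X => ((t, p.1), p.2) := by fun_prop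
    exact hK.measurable.comp h
  have hint : Integrable (fun p : X × X => star (transform μ K F t p.1) * (K t p.1 p.2 * H p.2))
      (μ.prod μ) := by
    have h2 : Integrable (fun p : X × X => H p.2) (μ.prod μ) := hHi.comp_snd μ
    have h3 := h2.bdd_mul (c := a * (B * (t ^ n)⁻¹))
      (f := fun p : X × X => star (transform μ K F t p.1) * K t p.1 p.2)
      ((hSs.comp measurable_fst).mul hKm).aestronglyMeasurable
      (Eventually.of_forall fun p => by
        rw [norm_mul, norm_star]
        exact mul_le_mul (hS _) (hK.norm_le_const ht _ _) (norm_nonneg _)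
          ((norm_nonneg _).trans (hS p.1)))
    simpa only [mul_assoc] using h3
  have h1 : ∫ x, star (transform μ K F t x) * transform μ K H t x ∂μ =
      ∫ y, cotransform μ K (transform μ K F) t y * H y ∂μ := by
    calc ∫ x, star (transform μ K F t x) * transform μ K H t x ∂μ
        = ∫ x, ∫ y, star (transform μ K F t x) * (K t x y * H y) ∂μ ∂μ := by
          refine integral_congr_ae (Eventually.of_forall fun x => ?_)
          exact (integral_const_mul _ _).symm
      _ = ∫ y, ∫ x, star (transform μ K F t x) * (K t x y * H y) ∂μ ∂μ :=
          integral_integral_swap hint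
      _ = _ := by
          refine integral_congr_ae (Eventually.of_forall fun y => ?_)
          simp only [cotransform, ← mul_assoc]
          exact integral_mul_const _ _
  have hci : Integrable (fun y => cotransform μ K (transform μ K F) t y * H y) μ := by
    have := hint.swap.integral_prod_left
    refine this.congr (Eventually.of_forall fun y => ?_)
    simp only [cotransform, ← mul_assoc, Function.comp_apply, Prod.swap_prod_mk]
    exact integral_mul_const _ _
  -- Subtracting `z` costs nothing, as `H` has mean zero. With `z` the value at `x₀`, it secures
  -- convergence of the `dt / t` integral at large `t`.
  rw [h1]
  simp_rw [sub_mul]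
  rw [integral_sub hci (hHi.const_mul z), integral_const_mul, h0, mul_zero, sub_zero]

/-- The function `∫ (cotransform(t, y) - cotransform(t, x₀)) dt / t` whose conjugate is, up to a
constant, a multiple of `F`. -/
noncomputable def reconstruct (μ : Measure X) (K : ℝ → X → X → ℂ) (F : X → ℂ) (x₀ y : X) : ℂ :=
  ∫ t, (cotransform μ K (transform μ K F) t y - cotransform μ K (transform μ K F) t x₀) ∂logMeasure

theorem norm_cotransform_transform_sub_le (hK : IsDecayingKernel n B K) (hA : 0 ≤ A)
    (hμ : ∀ (z : X) (ρ : ℝ), 0 < ρ → μ (Metric.ball z ρ) ≤ ENNReal.ofReal (A * ρ ^ n))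
    (hFm : Measurable F) (ha : 0 ≤ a)
    (hS : ∀ t : ℝ, 0 < t → ∀ x, ‖transform μ K F t x‖ ≤ a * t ^ α) {t : ℝ} (ht : 0 < t) (y y' : X) :
    ‖cotransform μ K (transform μ K F) t y' - cotransform μ K (transform μ K F) t y‖ ≤
      a * (2 * B * (A * 2 ^ n * 2)) * (t ^ α * min 1 (dist y y' / t)) := by
  have hSm : Measurable (transform μ K F t) :=
    (hK.measurable_transform hFm).comp measurable_prodMk_left
  refine (hK.norm_cotransform_sub_le hA hμ ht hSm (by positivity) (hS t ht) y y').trans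
    (le_of_eq ?_)
  ring

theorem integrable_cotransform_sub (hK : IsDecayingKernel n B K) (hA : 0 ≤ A)
    (hμ : ∀ (z : X) (ρ : ℝ), 0 < ρ → μ (Metric.ball z ρ) ≤ ENNReal.ofReal (A * ρ ^ n))
    (hFm : Measurable F) (hα0 : 0 < α) (hα1 : α < 1) (ha : 0 ≤ a)
    (hS : ∀ t : ℝ, 0 < t → ∀ x, ‖transform μ K F t x‖ ≤ a * t ^ α) (y y' : X) :
    Integrable (fun t => cotransform μ K (transform μ K F) t y' -
      cotransform μ K (transform μ K F) t y) logMeasure := by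
  have hm := hK.measurable_cotransform (μ := μ) (hK.measurable_transform (μ := μ) hFm)
  have hm' : ∀ y, Measurable fun t => cotransform μ K (transform μ K F) t y := fun y =>
    hm.comp measurable_prodMk_right
  refine ((integrable_logMeasure_rpow_min hα0 hα1 (dist_nonneg (x := y) (y := y'))).const_mul
    (a * (2 * B * (A * 2 ^ n * 2)))).mono' ((hm' y').sub (hm' y)).aestronglyMeasurable ?_
  filter_upwards [ae_logMeasure_pos] with t ht
  exact hK.norm_cotransform_transform_sub_le hA hμ hFm ha hS ht y y'

/-- The base point terms cancel, leaving the integral of `t^α min(1, d/t)` against `dt / t`. -/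
theorem norm_reconstruct_sub_le (hK : IsDecayingKernel n B K) (hA : 0 ≤ A)
    (hμ : ∀ (z : X) (ρ : ℝ), 0 < ρ → μ (Metric.ball z ρ) ≤ ENNReal.ofReal (A * ρ ^ n))
    (hFm : Measurable F) (hα0 : 0 < α) (hα1 : α < 1) (ha : 0 ≤ a)
    (hS : ∀ t : ℝ, 0 < t → ∀ x, ‖transform μ K F t x‖ ≤ a * t ^ α) (x₀ y y' : X) :
    ‖reconstruct μ K F x₀ y' - reconstruct μ K F x₀ y‖ ≤
      a * (2 * B * (A * 2 ^ n * 2)) * (α⁻¹ + (1 - α)⁻¹) * dist y y' ^ α := by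
  have hB := hK.nonneg
  have hi := hK.integrable_cotransform_sub hA hμ hFm hα0 hα1 ha hS
  rw [reconstruct, reconstruct, ← integral_sub (hi x₀ y') (hi x₀ y)]
  simp only [sub_sub_sub_cancel_right]
  calc _ ≤ ∫ t, a * (2 * B * (A * 2 ^ n * 2)) * (t ^ α * min 1 (dist y y' / t)) ∂logMeasure := by
        refine norm_integral_le_of_norm_le
          ((integrable_logMeasure_rpow_min hα0 hα1 dist_nonneg).const_mul _) ?_
        filter_upwards [ae_logMeasure_pos] with t ht
        exact hK.norm_cotransform_transform_sub_le hA hμ hFm ha hS ht y y'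
    _ = a * (2 * B * (A * 2 ^ n * 2)) * ∫ t, t ^ α * min 1 (dist y y' / t) ∂logMeasure :=
        integral_const_mul _ _
    _ ≤ a * (2 * B * (A * 2 ^ n * 2)) * ((α⁻¹ + (1 - α)⁻¹) * dist y y' ^ α) := by
        gcongr
        exact integral_logMeasure_rpow_min_le hα0 hα1 dist_nonneg
    _ = _ := by ring

/-- Weak form of the reconstruction formula. -/
theorem integral_star_transform_mul_transform (hK : IsDecayingKernel n B K) (hA : 0 ≤ A)
    (hμ : ∀ (z : X) (ρ : ℝ), 0 < ρ → μ (Metric.ball z ρ) ≤ ENNReal.ofReal (A * ρ ^ n))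
    (hFm : Measurable F) (hα0 : 0 < α) (hα1 : α < 1) (ha : 0 ≤ a)
    (hS : ∀ t : ℝ, 0 < t → ∀ x, ‖transform μ K F t x‖ ≤ a * t ^ α) (x₀ : X)
    (hHm : Measurable H) (hHi : Integrable H μ) (h0 : ∫ y, H y ∂μ = 0)
    (hint : Integrable (fun p => star (Function.uncurry (transform μ K F) p) *
      Function.uncurry (transform μ K H) p) (logMeasure.prod μ)) :
    ∫ p, star (Function.uncurry (transform μ K F) p) * Function.uncurry (transform μ K H) p
      ∂(logMeasure.prod μ) = ∫ y, reconstruct μ K F x₀ y * H y ∂μ := by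
  have hB := hK.nonneg
  set s := cotransform μ K (transform μ K F) with hs
  have hm : Measurable (Function.uncurry s) :=
    hK.measurable_cotransform (μ := μ) (hK.measurable_transform (μ := μ) hFm)
  have hswap : Integrable (fun p : ℝ × X => (s p.1 p.2 - s p.1 x₀) * H p.2)
      (logMeasure.prod μ) := by
    have hm2 : Measurable fun p : ℝ × X => s p.1 x₀ :=
      (hm.comp measurable_prodMk_right).comp measurable_fst
    -- Bounding distances by the diameter gives a majorant that is a product of functions of `t` and
    -- `y`, as Fubini requires.
    have hd := (integrable_logMeasure_rpow_min hα0 hα1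
      (Metric.diam_nonneg (s := (univ : Set X)))).const_mul (a * (2 * B * (A * 2 ^ n * 2)))
    refine (hd.mul_prod hHi.norm).mono'
      ((hm.sub hm2).mul (hHm.comp measurable_snd)).aestronglyMeasurable ?_
    filter_upwards [Measure.quasiMeasurePreserving_fst.ae ae_logMeasure_pos] with p hp
    rw [norm_mul]
    refine mul_le_mul_of_nonneg_right ((hK.norm_cotransform_transform_sub_le hA hμ hFm ha hS hp x₀
      p.2).trans ?_) (norm_nonneg _)
    gcongr
    exact Metric.dist_le_diam_of_mem isCompact_univ.isBounded (mem_univ _) (mem_univ _)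
  calc _ = ∫ t, ∫ x, star (transform μ K F t x) * transform μ K H t x ∂μ ∂logMeasure :=
        integral_prod _ hint
    _ = ∫ t, ∫ y, (s t y - s t x₀) * H y ∂μ ∂logMeasure := by
        refine integral_congr_ae ?_
        filter_upwards [ae_logMeasure_pos] with t ht
        exact hK.integral_star_transform_mul hFm hHi ht (hS t ht) (s t x₀) h0
    _ = ∫ y, ∫ t, (s t y - s t x₀) * H y ∂logMeasure ∂μ := integral_integral_swap hswap
    _ = _ := by
        refine integral_congr_ae (Eventually.of_forall fun y => ?_)
        exact integral_mul_const _ _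

/-- Decay of the wavelet transform at small scales implies Hölder continuity. -/
theorem exists_holder_of_norm_transform_le (hK : IsDecayingKernel n B K) (hA : 0 ≤ A)
    (hμ : ∀ (z : X) (ρ : ℝ), 0 < ρ → μ (Metric.ball z ρ) ≤ ENNReal.ofReal (A * ρ ^ n))
    (hc : 0 < c) (hiso : ∀ F : X → ℂ, Measurable F → MemLp F 2 μ →
      ∫⁻ t, ∫⁻ x, ‖transform μ K F t x‖ₑ ^ 2 ∂μ ∂logMeasure =
        ENNReal.ofReal c * ∫⁻ x, ‖F x - ⨍ y, F y ∂μ‖ₑ ^ 2 ∂μ)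
    (hFm : Measurable F) (hF : MemLp F 2 μ) (hα0 : 0 < α) (hα1 : α < 1) (ha : 0 ≤ a)
    (hS : ∀ t : ℝ, 0 < t → ∀ x, ‖transform μ K F t x‖ ≤ a * t ^ α) [Nonempty X] :
    ∃ G : X → ℂ, F =ᵐ[μ] G ∧ ∃ C : ℝ, 0 ≤ C ∧ ∀ y y', ‖G y' - G y‖ ≤ C * dist y y' ^ α := by
  have hB := hK.nonneg
  let x₀ : X := Classical.arbitrary X
  set g := reconstruct μ K F x₀ with hg
  have hgH := hK.norm_reconstruct_sub_le hA hμ hFm hα0 hα1 ha hS x₀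
  set D := a * (2 * B * (A * 2 ^ n * 2)) * (α⁻¹ + (1 - α)⁻¹) with hD
  have hα1' : 0 < 1 - α := by linarith
  have hD0 : 0 ≤ D := by positivity
  -- The weak formula pairs `g` with `H` bilinearly, whereas the isometry gives `c` times the
  -- Hermitian pairing with `F`; hence the conjugate and the division by `c`.
  let G : X → ℂ := fun y => star (g y) / c
  have hGH : ∀ y y', ‖G y' - G y‖ ≤ D / c * dist y y' ^ α := by
    intro y y'
    have : G y' - G y = star (g y' - g y) / c := by simp only [G, star_sub]; ring
    rw [this, norm_div, norm_star, Complex.norm_real, Real.norm_of_nonneg hc.le, div_mul_eq_mul_div]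
    gcongr
    exact hgH y y'
  have hGc : Continuous G := by
    have : HolderWith (D / c).toNNReal α.toNNReal G := holderWith_of_norm_sub_le (by positivity)
      fun y y' => by rw [Real.coe_toNNReal _ hα0.le]; exact hGH y y'
    exact this.continuous (by simpa using hα0)
  have hGL : MemLp G 2 μ := by
    obtain ⟨b, hb⟩ := isCompact_univ.exists_bound_of_continuousOn hGc.continuousOn
    exact MemLp.of_bound hGc.aestronglyMeasurable b (Eventually.of_forall fun x => hb x (mem_univ x))
  -- The test function is the difference to be shown zero, `(I - P)(F - G)`.
  let H : X → ℂ := fun y => (F y - ⨍ z, F z ∂μ) - (G y - ⨍ z, G z ∂μ)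
  have hF' : MemLp (fun y => F y - ⨍ z, F z ∂μ) 2 μ := hF.sub (memLp_const _)
  have hG' : MemLp (fun y => G y - ⨍ z, G z ∂μ) 2 μ := hGL.sub (memLp_const _)
  have hHL : MemLp H 2 μ := hF'.sub hG'
  have hHm : Measurable H := (hFm.sub_const _).sub (hGc.measurable.sub_const _)
  have hHi : Integrable H μ := hHL.integrable one_le_two
  have hH0 : ∫ y, H y ∂μ = 0 := by
    rw [integral_sub (hF'.integrable one_le_two) (hG'.integrable one_le_two),
      integral_sub_average, integral_sub_average, sub_zero]
  have hHavg : ⨍ y, H y ∂μ = 0 := by rw [average_eq, hH0, smul_zero]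
  have hfin : ∀ F' : X → ℂ, Measurable F' → MemLp F' 2 μ →
      MemLp (Function.uncurry (transform μ K F')) 2 (logMeasure.prod μ) := by
    intro F' hm' hL'
    refine hK.memLp_transform hm' ?_
    rw [hiso F' hm' hL']
    have h1 : MemLp (fun x => F' x - ⨍ y, F' y ∂μ) 2 μ := hL'.sub (memLp_const _)
    have h2 := (eLpNorm_lt_top_iff_lintegral_rpow_enorm_lt_top two_ne_zero
      ENNReal.ofNat_ne_top).1 h1.2
    simp only [ENNReal.toReal_ofNat, ENNReal.rpow_two] at h2
    exact ENNReal.mul_ne_top ENNReal.ofReal_ne_top h2.ne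
  have hint := integrable_star_mul (hfin F hFm hF) (hfin H hHm hHL)
  have hpol : (∫ p, star (Function.uncurry (transform μ K F) p) *
      Function.uncurry (transform μ K H) p ∂(logMeasure.prod μ)).re =
        c * (∫ x, star (F x - ⨍ y, F y ∂μ) * H x ∂μ).re := by
    refine re_integral_star_mul_eq_of_isometry (hfin F hFm hF) (hfin H hHm hHL) hF' hHL
      (hK.integral_norm_sq_transform hFm hc.le hF' (hiso F hFm hF))
      (hK.integral_norm_sq_transform hHm hc.le hHL ?_) ?_
    · simpa [hHavg] using hiso H hHm hHL
    · have hs := hK.integral_norm_sq_transform (hFm.add hHm) hc.le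
        ((hF.add hHL).sub (memLp_const _)) (hiso (F + H) (hFm.add hHm) (hF.add hHL))
      have havg : ⨍ y, (F + H) y ∂μ = ⨍ y, F y ∂μ := by
        rw [average_eq, average_eq]
        simp only [Pi.add_apply]
        rw [integral_add (hF.integrable one_le_two) hHi, hH0, add_zero]
      refine Eq.trans ?_ (hs.trans ?_)
      · refine integral_congr_ae ?_
        filter_upwards [Measure.quasiMeasurePreserving_fst.ae ae_logMeasure_pos] with p hp
        rw [show Function.uncurry (transform μ K (F + H)) p = _ from
          hK.transform_add (hF.integrable one_le_two) hHi hp p.2]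
        rfl
      · congr 1
        refine integral_congr_ae (Eventually.of_forall fun x => ?_)
        simp only [Pi.sub_apply, havg]
        simp only [Pi.add_apply]
        ring_nf
  rw [hK.integral_star_transform_mul_transform hA hμ hFm hα0 hα1 ha hS x₀ hHm hHi hH0 hint] at hpol
  have hgG : ∫ y, reconstruct μ K F x₀ y * H y ∂μ = c * ∫ y, star (G y) * H y ∂μ := by
    rw [← integral_const_mul]
    refine integral_congr_ae (Eventually.of_forall fun y => ?_)
    have hc' : (c : ℂ) ≠ 0 := by exact_mod_cast hc.ne'
    simp only [G, star_div₀, star_star]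
    rw [show star (c : ℂ) = c from Complex.conj_ofReal c, ← mul_assoc, mul_div_cancel₀ _ hc']
  rw [hgG, Complex.re_ofReal_mul] at hpol
  have hre := mul_left_cancel₀ hc.ne' hpol
  -- The mean of `G` drops out against `H`, and by `hre` the two remaining pairings have equal real
  -- parts.
  have hHH : ∫ y, star (H y) * H y ∂μ = ∫ x, star (F x - ⨍ y, F y ∂μ) * H x ∂μ -
      ∫ y, star (G y) * H y ∂μ := by
    have h1 : ∀ y, star (H y) * H y = (star (F y - ⨍ y, F y ∂μ) * H y - star (G y) * H y) +
        star (⨍ z, G z ∂μ) * H y := by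
      intro y
      simp only [H, star_sub]
      ring
    simp_rw [h1]
    have h2 : Integrable (fun y => star (F y - ⨍ y, F y ∂μ) * H y - star (G y) * H y) μ :=
      (integrable_star_mul hF' hHL).sub (integrable_star_mul hGL hHL)
    rw [integral_add h2 (hHi.const_mul _), integral_sub (integrable_star_mul hF' hHL) (integrable_star_mul hGL hHL),
      integral_const_mul, hH0, mul_zero, add_zero]
  have hzero : ∫ y, ‖H y‖ ^ 2 ∂μ = 0 := by
    have h1 : ∫ y, ‖H y‖ ^ 2 ∂μ = (∫ y, star (H y) * H y ∂μ).re := by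
      rw [show (∫ y, star (H y) * H y ∂μ).re = ∫ y, (star (H y) * H y).re ∂μ from
        (integral_re (integrable_star_mul hHL hHL)).symm]
      refine integral_congr_ae (Eventually.of_forall fun x => ?_)
      simp only [← Complex.normSq_eq_norm_sq, Complex.normSq_apply]
      simp
    rw [h1, hHH, Complex.sub_re, hre, sub_self]
  have hae : H =ᵐ[μ] 0 := by
    have := (integral_eq_zero_iff_of_nonneg (fun y => by positivity)
      (hHL.integrable_norm_pow two_ne_zero)).1 hzero
    filter_upwards [this] with y hy
    simpa using hy
  refine ⟨fun y => G y + (⨍ z, F z ∂μ - ⨍ z, G z ∂μ), ?_, D / c, by positivity, fun y y' => ?_⟩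
  · filter_upwards [hae] with y hy
    simp only [H, Pi.zero_apply] at hy
    linear_combination hy
  · simpa using hGH y y'

end IsDecayingKernel

end Reconstruction

/-! ### From wavelet hypotheses to decaying kernels. -/

section WaveletBounds

/-- Combines the cases `0` and `N` of (iv) through `(1+a)^N ≤ 2^(N-1) (1 + a^N)`, replacing `d/t` by
`1 + d/t`. -/
theorem mul_one_add_pow_mul_le {T a k C₀ C₁ : ℝ} (hT : 0 ≤ T) (ha : 0 ≤ a) (hk : 0 ≤ k) (N : ℕ)
    (h₀ : T * (a ^ 0 * k) ≤ C₀) (h₁ : T * (a ^ N * k) ≤ C₁) :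
    T * ((1 + a) ^ N * k) ≤ 2 ^ (N - 1) * (C₀ + C₁) := by
  have h := add_pow_le zero_le_one ha N
  calc T * ((1 + a) ^ N * k) ≤ T * (2 ^ (N - 1) * (1 ^ N + a ^ N) * k) := by gcongr
    _ = 2 ^ (N - 1) * (T * (a ^ 0 * k) + T * (a ^ N * k)) := by ring
    _ ≤ _ := by gcongr

theorem eLpNorm_two_sq {X : Type*} [MeasurableSpace X] (μ : Measure X) (f : X → ℂ) :
    eLpNorm f 2 μ ^ 2 = ∫⁻ x, ‖f x‖ₑ ^ 2 ∂μ := by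
  have h := eLpNorm_nnreal_pow_eq_lintegral (f := f) (μ := μ) (p := 2) two_ne_zero
  simpa using h

variable {n : ℕ} {M : Type*} [MetricSpace M] [CompactSpace M]
  [ChartedSpace (𝔼 n) M] [IsManifold (𝓡 n) ∞ M]
  [RiemannianBundle (fun x : M => TangentSpace (𝓡 n) x)]
  [MeasurableSpace M] {K : ℝ → M → M → ℂ}

/-- The kernel `K_t`, extended by zero to `t ≤ 0`. -/
noncomputable def extendKernel (K : ℝ → M → M → ℂ) (t : ℝ) (x y : M) : ℂ :=
  if 0 < t then K t x y else 0

/-- Smoothness is available only for `t > 0`; the extension by zero is Borel for all `t`, so the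
transforms are jointly measurable. -/
theorem IsContinuousWavelet.measurable_extendKernel [BorelSpace M]
    (hK : IsContinuousWavelet n K) :
    Measurable fun p : (ℝ × M) × M => extendKernel K p.1.1 p.1.2 p.2 := by
  classical
  have h := hK.smooth.continuousOn.measurable_piecewise
    (g := fun _ : ℝ × M × M => (0 : ℂ)) continuousOn_const
    (measurableSet_Ioi.prod MeasurableSet.univ)
  have h2 : Measurable fun p : (ℝ × M) × M => (p.1.1, p.1.2, p.2) := by fun_prop
  convert h.comp h2 using 1
  ext p
  simp [extendKernel, piecewise]

theorem IsContinuousWavelet.contMDiff_right (hK : IsContinuousWavelet n K) {t : ℝ} (ht : 0 < t)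
    (x : M) : ContMDiff (𝓡 n) 𝓘(ℝ, ℂ) ∞ fun y => K t x y := by
  have h1 : ContMDiff (𝓡 n) (𝓘(ℝ, ℝ).prod ((𝓡 n).prod (𝓡 n))) ∞ fun y : M => (t, x, y) :=
    contMDiff_const.prodMk (contMDiff_const.prodMk contMDiff_id)
  exact hK.smooth.comp_contMDiff h1 fun y => ⟨ht, mem_univ _⟩

theorem IsContinuousSWavelet.exists_norm_le (hK : IsContinuousSWavelet n K) :
    ∃ B : ℝ, ∀ t : ℝ, 0 < t → ∀ x y,
      (1 + dist x y / t) * ‖K t x y‖ ≤ B * decayWeight n t x y := by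
  obtain ⟨C₀, h₀⟩ := hK.decay 0 0 _ _ IsDiffOp.id IsDiffOp.id 0
  -- Of the `n + 2` powers, `n + 1` form the weight and one is the spare factor.
  obtain ⟨C₁, h₁⟩ := hK.decay 0 0 _ _ IsDiffOp.id IsDiffOp.id (n + 2)
  refine ⟨2 ^ (n + 1) * (C₀ + C₁), fun t ht x y => ?_⟩
  have ha : 0 ≤ dist x y / t := by positivity
  have h := mul_one_add_pow_mul_le (pow_nonneg ht.le n) ha (norm_nonneg (K t x y)) (n + 2)
    (h₀ t ht x y) (h₁ t ht x y)
  have hpos : 0 < t ^ n * (1 + dist x y / t) ^ (n + 1) := by positivity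
  rw [decayWeight, inv_eq_one_div, div_div, mul_one_div,
    mul_comm ((1 + dist x y / t) ^ (n + 1)) (t ^ n), le_div_iff₀ hpos]
  calc _ = t ^ n * ((1 + dist x y / t) ^ (n + 2) * ‖K t x y‖) := by ring
    _ ≤ _ := h

variable [IsContMDiffRiemannianBundle (𝓡 n) ∞ (𝔼 n) (fun x : M => TangentSpace (𝓡 n) x)]

/-- Hypothesis (iv) is applied to finitely many global fields that control every direction; degree
one in `y` costs the extra `1 / t`. -/
theorem IsContinuousSWavelet.exists_dirDeriv_le (hK : IsContinuousSWavelet n K) :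
    ∃ B : ℝ, 0 ≤ B ∧ ∀ t : ℝ, 0 < t → ∀ (x z : M) (v : TangentSpace (𝓡 n) z),
      ‖dirDeriv (K t x) z v‖ ≤ B / t * decayWeight n t x z * ‖v‖ := by
  obtain ⟨s, V, hV, C, hC0, hC⟩ := exists_vectorFields (n := n) (M := M) ℂ
  choose b hb using fun (N : ℕ) (p : M) (i : Fin n) =>
    hK.decay 0 1 _ _ IsDiffOp.id (IsDiffOp.deriv (V p i) (hV p i) IsDiffOp.id) N
  let D : ℕ → ℝ := fun N => ∑ p ∈ s, ∑ i, |b N p i|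
  have hD0 : ∀ N, 0 ≤ D N := fun N =>
    Finset.sum_nonneg fun p _ => Finset.sum_nonneg fun i _ => abs_nonneg _
  have hD : ∀ N, ∀ p ∈ s, ∀ i, b N p i ≤ D N := fun N p hp i =>
    (le_abs_self _).trans ((Finset.single_le_sum (f := fun i => |b N p i|)
      (fun i _ => abs_nonneg _) (Finset.mem_univ i)).trans
      (Finset.single_le_sum (f := fun p => ∑ i, |b N p i|)
        (fun p _ => Finset.sum_nonneg fun i _ => abs_nonneg _) hp))
  refine ⟨C * (2 ^ n * (D 0 + D (n + 1))),
    mul_nonneg hC0 (mul_nonneg (by positivity) (add_nonneg (hD0 _) (hD0 _))),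
    fun t ht x z v => ?_⟩
  have ha : 0 ≤ dist x z / t := by positivity
  have h := hC (K t x) z (2 ^ n * (D 0 + D (n + 1)) / t * decayWeight n t x z)
    (mul_nonneg (div_nonneg (mul_nonneg (by positivity) (add_nonneg (hD0 _) (hD0 _))) ht.le)
      (decayWeight_nonneg ht x z)) (fun p hp i => ?_) v
  · refine h.trans (le_of_eq ?_)
    ring
  · have h := mul_one_add_pow_mul_le (pow_nonneg ht.le (n + 1)) ha
      (norm_nonneg (dirDeriv (K t x) z (V p i z))) (n + 1)
      ((hb 0 p i t ht x z).trans (hD 0 p hp i))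
      ((hb (n + 1) p i t ht x z).trans (hD (n + 1) p hp i))
    have hpos : 0 < t * (t ^ n * (1 + dist x z / t) ^ (n + 1)) := by positivity
    rw [decayWeight, inv_eq_one_div, div_div, div_mul_div_comm, mul_one,
      mul_comm (_ ^ (n + 1)) (t ^ n), le_div_iff₀ hpos]
    calc _ = t ^ (n + 1) * ((1 + dist x z / t) ^ (n + 1) * ‖dirDeriv (K t x) z (V p i z)‖) := by
          ring
      _ ≤ _ := h

theorem IsContinuousSWavelet.exists_norm_sub_le [IsRiemannianManifold (𝓡 n) M]
    (hK : IsContinuousSWavelet n K) :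
    ∃ B : ℝ, ∀ t : ℝ, 0 < t → ∀ x y y' : M, dist y y' ≤ t →
      ‖K t x y' - K t x y‖ ≤ B * (dist y y' / t) * decayWeight n t x y := by
  obtain ⟨B, hB0, hB⟩ := hK.exists_dirDeriv_le
  refine ⟨B * 3 ^ (n + 1), fun t ht x y y' hd => ?_⟩
  -- For distinct points the radius `2 * dist y y'` strictly exceeds their distance, as the mean
  -- value inequality requires.
  rcases eq_or_ne y y' with rfl | hne
  · simp
  have hpos : 0 < dist y y' := dist_pos.2 hne
  -- As `dist y y' ≤ t`, moving from `y` to `z` changes `1 + d/t` by a factor of at most 3.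
  have hw : ∀ z ∈ Metric.ball y (2 * dist y y'),
      decayWeight n t x z ≤ 3 ^ (n + 1) * decayWeight n t x y := by
    intro z hz
    have h1 : dist x y ≤ dist x z + 2 * t := by
      have := Metric.mem_ball.1 hz
      linarith [dist_triangle x z y]
    have h2 : 1 + dist x y / t ≤ 3 * (1 + dist x z / t) := by
      have h3 : dist x y / t ≤ dist x z / t + 2 := by
        rw [div_add' _ _ _ ht.ne']
        gcongr
      have : 0 ≤ dist x z / t := by positivity
      linarith
    unfold decayWeight
    rw [← mul_div_assoc]
    gcongr
    rw [← div_eq_mul_inv, inv_eq_one_div, div_le_div_iff₀ (by positivity) (by positivity), one_mul,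
      ← mul_pow]
    gcongr
  have h := norm_sub_le_of_dirDeriv_le (n := n) (f := K t x) (y := y) (y' := y')
    (R := 2 * dist y y') (C := B / t * (3 ^ (n + 1) * decayWeight n t x y))
    (mul_nonneg (by positivity) (mul_nonneg (by positivity) (decayWeight_nonneg ht x y)))
    (by linarith) (fun z _ => ((hK.contMDiff_right ht x).of_le (by simp)).contMDiffAt)
    (fun z hz v => (hB t ht x z v).trans (by gcongr; exact hw z hz))
  refine h.trans (le_of_eq ?_)
  ring

theorem IsContinuousSWavelet.exists_isDecayingKernel [IsRiemannianManifold (𝓡 n) M] [BorelSpace M]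
    (hK : IsContinuousSWavelet n K) : ∃ B : ℝ, IsDecayingKernel n B (extendKernel K) := by
  obtain ⟨B₁, h₁⟩ := hK.exists_norm_le
  obtain ⟨B₂, h₂⟩ := hK.exists_norm_sub_le
  refine ⟨max (max B₁ B₂) 0, hK.measurable_extendKernel, le_max_right _ _, fun t ht x y => ?_,
    fun t ht x y y' hd => ?_⟩
  · simp only [extendKernel, if_pos ht]
    exact (h₁ t ht x y).trans (mul_le_mul_of_nonneg_right
      ((le_max_left _ _).trans (le_max_left _ _)) (decayWeight_nonneg ht x y))
  · simp only [extendKernel, if_pos ht]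
    refine (h₂ t ht x y y' hd).trans (mul_le_mul_of_nonneg_right
      (mul_le_mul_of_nonneg_right ((le_max_right _ _).trans (le_max_left _ _)) (by positivity))
      (decayWeight_nonneg ht x y))

/-- Allows a change of representative: the Hölder one in (a), a measurable one in (b). -/
theorem transform_extendKernel {F G : M → ℂ} (hFG : F =ᵐ[riemannianVolume n M] G) {t : ℝ}
    (ht : 0 < t) (x : M) :
    transform (riemannianVolume n M) (extendKernel K) G t x = kernelOp n K t F x := by
  refine integral_congr_ae ?_
  filter_upwards [hFG] with y hy
  simp [extendKernel, ht, hy]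

theorem IsContinuousWavelet.exists_lintegral_transform (hK : IsContinuousWavelet n K) :
    ∃ c : ℝ, 0 < c ∧ ∀ F : M → ℂ, MemLp F 2 (riemannianVolume n M) →
      ∫⁻ t, ∫⁻ x, ‖transform (riemannianVolume n M) (extendKernel K) F t x‖ₑ ^ 2
          ∂(riemannianVolume n M) ∂logMeasure =
        ENNReal.ofReal c * ∫⁻ x, ‖F x - ⨍ y, F y ∂(riemannianVolume n M)‖ₑ ^ 2
          ∂(riemannianVolume n M) := by
  obtain ⟨c, hc, h⟩ := hK.isometry
  refine ⟨c, hc, fun F hF => ?_⟩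
  have h1 := h F hF
  rw [eLpNorm_two_sq] at h1
  refine Eq.trans ?_ h1
  rw [lintegral_logMeasure]
  refine setLIntegral_congr_fun measurableSet_Ioi fun t ht => ?_
  rw [eLpNorm_two_sq]
  simp_rw [transform_extendKernel (K := K) (EventuallyEq.refl _ F) ht]

end WaveletBounds

/-! ### Assembly of the two parts. -/

theorem theorem5p4 {n : ℕ} {M : Type*} [MetricSpace M] [CompactSpace M] [ConnectedSpace M]
    [ChartedSpace (𝔼 n) M] [IsManifold (𝓡 n) ∞ M]
    [RiemannianBundle (fun x : M => TangentSpace (𝓡 n) x)]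
    [IsContMDiffRiemannianBundle (𝓡 n) ∞ (𝔼 n) (fun x : M => TangentSpace (𝓡 n) x)]
    [IsRiemannianManifold (𝓡 n) M]
    [MeasurableSpace M] [BorelSpace M]
    (K : ℝ → M → M → ℂ) (hK : IsContinuousSWavelet n K)
    (F : M → ℂ) (hF : MemLp F 2 (riemannianVolume n M)) :
    (∀ α : ℝ≥0, 0 < α → α ≤ 1 → IsHolderClass n α F →
      ∃ C : ℝ, 0 < C ∧ ∀ t : ℝ, 0 < t → ∀ x : M, ‖kernelOp n K t F x‖ ≤ C * t ^ (α : ℝ)) ∧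
    (∀ α : ℝ≥0, 0 < α → α < 1 → ∀ C : ℝ, 0 < C →
      (∀ t : ℝ, 0 < t → ∀ x : M, ‖kernelOp n K t F x‖ ≤ C * t ^ (α : ℝ)) →
      IsHolderClass n α F) := by
  have := isFiniteMeasure_riemannianVolume (n := n) (M := M)
  obtain ⟨A, hA, hμ⟩ := exists_riemannianVolume_ball_le (n := n) (M := M)
  obtain ⟨B, hB⟩ := hK.exists_isDecayingKernel
  have hB0 := hB.nonneg
  constructor
  · rintro α hα0 hα1 ⟨G, hFG, C, hG⟩
    -- The product may vanish; adding 1 makes the constant positive.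
    refine ⟨B * C * (A * 2 ^ n * 2) + 1, by positivity, fun t ht x => ?_⟩
    rw [← transform_extendKernel hFG ht x]
    have h0 : ∫ y, extendKernel K t x y ∂(riemannianVolume n M) = 0 := by
      simpa [extendKernel, ht] using hK.integral_right t ht x
    refine (hB.norm_integral_le_of_holder hA hμ ((hF.integrable one_le_two).congr hFG)
      α.coe_nonneg (by exact_mod_cast hα1) C.coe_nonneg (fun x y => ?_) ht x h0).trans ?_
    · rw [← dist_eq_norm, dist_comm]
      exact hG.dist_le x y
    · gcongr
      linarith
  · intro α hα0 hα1 C hC h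
    obtain ⟨c, hc, hiso⟩ := hK.exists_lintegral_transform
    have hFG := hF.1.ae_eq_mk
    obtain ⟨G, hG, D, hD, hGD⟩ := hB.exists_holder_of_norm_transform_le hA hμ hc
      (fun F _ hF => hiso F hF) hF.1.stronglyMeasurable_mk.measurable (hF.ae_eq hFG)
      (α := α) (by exact_mod_cast hα0) (by exact_mod_cast hα1) hC.le
      (fun t ht x => by rw [transform_extendKernel hFG ht x]; exact h t ht x)
    exact ⟨G, hFG.trans hG, D.toNNReal, holderWith_of_norm_sub_le hD hGD⟩
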